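/- \textbf{Hardy--Littlewood--Sobolev inequality in modulation spaces.} Let $d\in\mathbb N$, $0<\gamma<d$, $1<p_1<p_2<\infty$ with $$\frac1{p_1}+\frac{\gamma}{d}-1=\frac1{p_2},$$ let $1\le q\le\infty$ and $s\ge 0$, and fix a window $0\ne g\in\mathcal S(\mathbb R^d)$. For $f\in\mathcal S'(\mathbb R^d)$ let $V_gf(x,w)=\langle f, M_wT_xg\rangle$, with $M_wT_xg(t)=e^{2\pi i w\cdot t}g(t-x)$, be the short-time Fourier transform (for functions, $V_gf(x,w)=\int f(t)\overline{g(t-x)}e^{-2\pi i w\cdot t}\,dt$). For $1\le p\le\infty$ put $$\|f\|_{M^{p,q}_s}=\Big\|\,(1+|w|^2)^{s/2}\,\|V_gf(\cdot,w)\|_{L^p(\mathbb R^d)}\Big\|_{L^q_w(\mathbb R^d)},\qquad M^{p,q}_s(\mathbb R^d)=\{f\in\mathcal S'(\mathbb R^d):\|f\|_{M^{p,q}_s}<\infty\}.$$ Let $T_\gamma f=|\cdot|^{-\gamma}*f$ be the fractional integral operator. For a tempered distribution $f$, $T_\gamma f$ is defined and equal to $h\in\mathcal S'(\mathbb R^d)$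 if for every $\varphi\in\mathcal S(\mathbb R^d)$ and every $x\in\mathbb R^d$ the integral below converges absolutely and $$(h*\varphi)(x)=\int_{\mathbb R^d}\frac{(f*\varphi)(y)}{|x-y|^{\gamma}}\,dy ;$$ such an $h$ is unique, and $T_\gamma$ is linear on the space of those $f$ for which it exists. Then: (i) for every $u\in\mathcal S(\mathbb R^d)$, $T_\gamma u$ is defined and is the tempered distribution given by the function $x\mapsto\int_{\mathbb R^d}u(y)|x-y|^{-\gamma}\,dy$, where the integral converges absolutely for every $x$; (ii) $T_\gamma f$ is defined for every $f\in M^{p_1,q}_s(\mathbb R^d)$, and $T_\gamma$ is bounded from $M^{p_1,q}_s(\mathbb R^d)$ to $M^{p_2,q}_s(\mathbb R^d)$: there is a constant $C$, not depending on $f$, such that $$\|T_\gamma f\|_{M^{p_2,q}_s}\le C\,\|f\|_{M^{p_1,q}_s}\qquad\text{for all } f\in M^{p_1,q}_s(\mathbb R^d).$$ -/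

import Mathlib

open MeasureTheory SchwartzMap
open scoped ENNReal NNReal

noncomputable section

namespace Modulation

/-- Euclidean space `ℝ^d`. -/
abbrev Eucl (d : ℕ) : Type := EuclideanSpace ℝ (Fin d)

variable {d : ℕ}

/-! ### Translation, modulation and conjugation of Schwartz functions -/

/-- The character `t ↦ exp (2πi ⟨w, t⟩)`. -/
def character (w t : Eucl d) : ℂ :=
  Complex.exp (((2 * Real.pi * inner ℝ w t : ℝ) : ℂ) * Complex.I)

theorem hasTemperateGrowth_character (w : Eucl d) :
    Function.HasTemperateGrowth (character w) := by
  have key : Function.HasTemperateGrowth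
      (fun r : ℝ => Complex.exp ((r : ℂ) * Complex.I)) := by
    have hit : ∀ n : ℕ, iteratedDeriv n (fun r : ℝ => Complex.exp ((r : ℂ) * Complex.I)) =
        fun r : ℝ => Complex.I ^ n * Complex.exp ((r : ℂ) * Complex.I) := by
      intro n
      induction n with
      | zero => simp
      | succ n ih =>
        rw [iteratedDeriv_succ, ih]
        funext r
        have h1 : HasDerivAt (fun r : ℝ => (r : ℂ) * Complex.I) (1 * Complex.I) r :=
          (HasDerivAt.ofReal_comp (hasDerivAt_id r)).mul_const Complex.I
        have h2 := (h1.cexp.const_mul (Complex.I ^ n)).deriv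
        rw [h2]
        ring
    refine ⟨?_, fun n => ⟨0, 1, fun r => ?_⟩⟩
    · exact (Complex.ofRealCLM.contDiff.mul contDiff_const).cexp
    · rw [norm_iteratedFDeriv_eq_norm_iteratedDeriv, hit n]
      simp [Complex.norm_exp_ofReal_mul_I]
  have hlin : Function.HasTemperateGrowth (fun t : Eucl d => 2 * Real.pi * inner ℝ w t) :=
    (Function.HasTemperateGrowth.const (2 * Real.pi)).mul
      (Function.hasTemperateGrowth_inner_right w)
  exact key.comp hlin

/-- The modulation `M_w φ (t) = exp (2πi ⟨w, t⟩) φ (t)`. -/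
def modulate (w : Eucl d) (φ : 𝓢(Eucl d, ℂ)) : 𝓢(Eucl d, ℂ) :=
  SchwartzMap.smulLeftCLM ℂ (character w) φ

theorem modulate_apply (w : Eucl d) (φ : 𝓢(Eucl d, ℂ)) (t : Eucl d) :
    modulate w φ t = character w t * φ t := by
  simp [modulate, SchwartzMap.smulLeftCLM_apply_apply (hasTemperateGrowth_character w)]

/-- The translation `T_x φ (t) = φ (t - x)`. -/
def translate (x : Eucl d) (φ : 𝓢(Eucl d, ℂ)) : 𝓢(Eucl d, ℂ) :=
  SchwartzMap.compSubConstCLM ℂ x φ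

theorem translate_apply (x : Eucl d) (φ : 𝓢(Eucl d, ℂ)) (t : Eucl d) :
    translate x φ t = φ (t - x) := rfl

/-- The complex conjugate of a Schwartz function. -/
def conjugate (φ : 𝓢(Eucl d, ℂ)) : 𝓢(Eucl d, ℂ) :=
  SchwartzMap.postcompCLM (𝕜 := ℝ) (Complex.conjCLE : ℂ →L[ℝ] ℂ) φ

theorem conjugate_apply (φ : 𝓢(Eucl d, ℂ)) (t : Eucl d) :
    conjugate φ t = (starRingEnd ℂ) (φ t) := rfl

/-- The reflection `t ↦ φ (-t)` of a Schwartz function. -/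
def reflect (φ : 𝓢(Eucl d, ℂ)) : 𝓢(Eucl d, ℂ) :=
  SchwartzMap.compCLMOfContinuousLinearEquiv ℂ (ContinuousLinearEquiv.neg ℝ) φ

theorem reflect_apply (φ : 𝓢(Eucl d, ℂ)) (t : Eucl d) :
    reflect φ t = φ (-t) := rfl

/-! ### Short-time Fourier transform and modulation spaces -/

/-- The short-time Fourier transform `V_g f (x, w) = ⟨f, M_w T_x g⟩` of a tempered
distribution, i.e. `f` applied to `conj (M_w T_x g)`, the Schwartz function
`t ↦ conj (g (t - x)) exp (-2πi ⟨w, t⟩)`. -/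
def stft (g : 𝓢(Eucl d, ℂ)) (f : 𝓢'(Eucl d, ℂ)) (x w : Eucl d) : ℂ :=
  f (conjugate (modulate w (translate x g)))

/-- On Schwartz functions this is the usual integral. -/
theorem stft_schwartz (g f : 𝓢(Eucl d, ℂ)) (x w : Eucl d) :
    stft g (SchwartzMap.toTemperedDistributionCLM (Eucl d) ℂ volume f) x w =
      ∫ t, f t * (starRingEnd ℂ) (g (t - x)) *
        Complex.exp (-2 * Real.pi * Complex.I * ((inner ℝ w t : ℝ) : ℂ)) := by
  refine (SchwartzMap.toTemperedDistributionCLM_apply_apply volume f _).trans ?_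
  refine integral_congr_ae (Filter.Eventually.of_forall fun t => ?_)
  have h : (starRingEnd ℂ) (character w t) =
      Complex.exp (-2 * Real.pi * Complex.I * ((inner ℝ w t : ℝ) : ℂ)) := by
    rw [character, ← Complex.exp_conj]
    congr 1
    rw [map_mul, Complex.conj_ofReal, Complex.conj_I]
    push_cast
    ring
  simp only [conjugate_apply, modulate_apply, translate_apply, map_mul, h, smul_eq_mul]
  ring

/-- The norm of `M^{p,q}_s` with window `g`, with values in `[0, ∞]`: the `L^q` norm in `w` of
`⟨w⟩^s` times the `L^p` norm in `x` of `V_g f (x, w)`, where `⟨w⟩ = (1 + |w|²)^{1/2}`. -/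
def modNorm (g : 𝓢(Eucl d, ℂ)) (p q : ℝ≥0∞) (s : ℝ) (f : 𝓢'(Eucl d, ℂ)) : ℝ≥0∞ :=
  eLpNorm (fun w : Eucl d =>
    eLpNorm (fun x : Eucl d => stft g f x w) p volume *
      ENNReal.ofReal ((1 + ‖w‖ ^ 2) ^ (s / 2))) q volume

/-- The modulation space `M^{p,q}_s(ℝ^d)` (with window `g`). -/
def modSpace (g : 𝓢(Eucl d, ℂ)) (p q : ℝ≥0∞) (s : ℝ) : Set 𝓢'(Eucl d, ℂ) :=
  {f | modNorm g p q s f < ∞}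

/-! ### The fractional integral operator -/

/-- `(T_γ u)(x) = ∫ u(y) / |x - y|^γ dy` for functions. -/
def fracInt (γ : ℝ) (u : Eucl d → ℂ) (x : Eucl d) : ℂ :=
  ∫ y, u y / ((‖x - y‖ ^ γ : ℝ) : ℂ)

/-- The convolution `(f * φ)(x) = f (φ (x - ·))` of a tempered distribution with a Schwartz
function. -/
def conv (f : 𝓢'(Eucl d, ℂ)) (φ : 𝓢(Eucl d, ℂ)) (x : Eucl d) : ℂ :=
  f (translate x (reflect φ))

theorem conv_add (f f' : 𝓢'(Eucl d, ℂ)) (φ : 𝓢(Eucl d, ℂ)) :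
    conv (f + f') φ = conv f φ + conv f' φ := rfl

theorem conv_smul (c : ℂ) (f : 𝓢'(Eucl d, ℂ)) (φ : 𝓢(Eucl d, ℂ)) :
    conv (c • f) φ = c • conv f φ := rfl

/-- `h` is the convolution `|·|^{-γ} * f` of tempered distributions: for every Schwartz
function `φ` the convolution of `|·|^{-γ}` with the smooth function `f * φ` converges absolutely
at every point and is equal to `h * φ`. -/
def IsFracInt (γ : ℝ) (f h : 𝓢'(Eucl d, ℂ)) : Prop :=
  ∀ (φ : 𝓢(Eucl d, ℂ)) (x : Eucl d),
    Integrable (fun y => conv f φ y / ((‖x - y‖ ^ γ : ℝ) : ℂ)) ∧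
      conv h φ x = fracInt γ (conv f φ) x

theorem IsFracInt.unique {γ : ℝ} {f h h' : 𝓢'(Eucl d, ℂ)}
    (H : IsFracInt γ f h) (H' : IsFracInt γ f h') : h = h' := by
  ext φ
  have e : translate 0 (reflect (reflect φ)) = φ := by
    ext t
    simp [translate_apply, reflect_apply]
  have := ((H (reflect φ) 0).2).trans ((H' (reflect φ) 0).2).symm
  simpa only [conv, e] using this

theorem IsFracInt.add {γ : ℝ} {f f' h h' : 𝓢'(Eucl d, ℂ)}
    (H : IsFracInt γ f h) (H' : IsFracInt γ f' h') : IsFracInt γ (f + f') (h + h') := by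
  intro φ x
  have e : (fun y => conv (f + f') φ y / ((‖x - y‖ ^ γ : ℝ) : ℂ)) =
      (fun y => conv f φ y / ((‖x - y‖ ^ γ : ℝ) : ℂ)) +
        fun y => conv f' φ y / ((‖x - y‖ ^ γ : ℝ) : ℂ) := by
    funext y
    simp only [conv_add, Pi.add_apply, add_div]
  refine ⟨?_, ?_⟩
  · rw [e]
    exact (H φ x).1.add (H' φ x).1
  · rw [fracInt, e, integral_add' (H φ x).1 (H' φ x).1, conv_add, Pi.add_apply, (H φ x).2,
      (H' φ x).2]
    rfl

theorem IsFracInt.smul {γ : ℝ} (c : ℂ) {f h : 𝓢'(Eucl d, ℂ)}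
    (H : IsFracInt γ f h) : IsFracInt γ (c • f) (c • h) := by
  intro φ x
  have e : (fun y => conv (c • f) φ y / ((‖x - y‖ ^ γ : ℝ) : ℂ)) =
      fun y => c * (conv f φ y / ((‖x - y‖ ^ γ : ℝ) : ℂ)) := by
    funext y
    simp only [conv_smul, Pi.smul_apply, smul_eq_mul, mul_div_assoc]
  refine ⟨?_, ?_⟩
  · rw [e]
    exact (H φ x).1.const_mul c
  · rw [fracInt, e, integral_const_mul, conv_smul, Pi.smul_apply, (H φ x).2]
    rfl

/-- The fractional integral operator `T_γ f = |·|^{-γ} * f`, as a linear operator in the space of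
tempered distributions, with domain the set of all `f` for which the convolution exists. -/
def fracIntOp (d : ℕ) (γ : ℝ) : 𝓢'(Eucl d, ℂ) →ₗ.[ℂ] 𝓢'(Eucl d, ℂ) where
  domain :=
    { carrier := {f | ∃ h, IsFracInt γ f h}
      add_mem' := fun ⟨_, H⟩ ⟨_, H'⟩ => ⟨_, H.add H'⟩
      zero_mem' := by
        refine ⟨0, fun φ x => ?_⟩
        have e : conv (0 : 𝓢'(Eucl d, ℂ)) φ = 0 := rfl
        simp [e, fracInt]
      smul_mem' := fun c _ ⟨_, H⟩ => ⟨_, H.smul c⟩ }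
  toFun :=
    { toFun := fun f => f.2.choose
      map_add' := fun f f' =>
        (f + f').2.choose_spec.unique (f.2.choose_spec.add f'.2.choose_spec)
      map_smul' := fun c f => (c • f).2.choose_spec.unique (f.2.choose_spec.smul c) }

theorem fracIntOp_spec (γ : ℝ) (f : (fracIntOp d γ).domain) :
    IsFracInt γ (f : 𝓢'(Eucl d, ℂ)) (fracIntOp d γ f) :=
  f.2.choose_spec

end Modulation

end

/-!
Convolution with `|·|^(-γ)` acts only on the space variable of the short-time Fourier transform:
at a fixed frequency `w`, and up to a unimodular factor, `V_g f (·, w)` is the convolution of `f`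
with a Schwartz function `χ_w` (`stft_eq_character_mul_conv`). By the definition of `T_γ` on
tempered distributions, `(T_γ f) * χ_w` is the fractional integral of the function `f * χ_w`, so
that `|V_g (T_γ f) (x, w)| ≤ ∫ |V_g f (y, w)| |x - y|^(-γ) dy` (`IsFracInt.enorm_stft_le`). The
classical Hardy–Littlewood–Sobolev inequality, applied in `x` for each `w`, gives the bound with a
constant that depends neither on `w` nor on `q`, `s` and `g` (`exists_modNorm_le_of_isFracInt`).

The classical inequality (`exists_lintegral_rieszPotential_rpow_le`) is proved by Hedberg's
argument. The integral is split at a radius `R`: the part near the singularity is bounded by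
`R^(d-γ)` times the maximal function, the part far from it by Hölder's inequality, and optimizing
in `R` gives a pointwise bound by a power of the maximal function. The `L^p` bound for the maximal
function follows from its weak-type bound, which is Vitali's covering lemma, and the layer-cake
formula.

What remains is the existence of `T_γ f` for `f` in the modulation space. By
`exists_isFracInt_of_lintegral_le` it suffices to bound `∫ |f (φ (· - y))| |y|^(-γ) dy` by a
continuous seminorm of `φ`. For `|y| < 1` this holds for every tempered distribution, since
`|y|^(-γ)` is locally integrable. For `|y| ≥ 1` the inversion formula for the short-time Fourier
transform (`enorm_apply_le_lintegral_stft`) bounds `|f (φ (· - y))|` by the integral of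
`|V_g f (x + y, w)|` against a rapidly decaying function of `(x, w)`; at each `w` the integral over `y` is
bounded by `‖V_g f (·, w)‖_{p₁}` with Hölder's inequality, and these norms are integrable against
the decay in `w`. The inversion formula rests on the fact that a tempered distribution commutes
with absolutely convergent integrals of Schwartz functions (`apply_eq_integral`): by the
Hahn–Banach theorem it factors through finitely many weighted derivatives, which lie in a Banach
space of bounded continuous functions, where the Bochner integral is available.
-/

namespace Modulation

variable {d : ℕ}

/-! ### The Hardy–Littlewood maximal function -/

/-- The centred Hardy–Littlewood maximal function, over open balls. -/
noncomputable def maximalFun (u : Eucl d → ℝ≥0∞) (x : Eucl d) : ℝ≥0∞ :=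
  ⨆ r : {r : ℝ // 0 < r}, ⨍⁻ y in Metric.ball x r, u y ∂volume

theorem volume_ball_ne_zero (x : Eucl d) {r : ℝ} (hr : 0 < r) : volume (Metric.ball x r) ≠ 0 :=
  (Metric.measure_ball_pos volume x hr).ne'

theorem setLIntegral_ball_le_maximalFun (u : Eucl d → ℝ≥0∞) (x : Eucl d) {r : ℝ} (hr : 0 < r) :
    ∫⁻ y in Metric.ball x r, u y ≤ volume (Metric.ball x r) * maximalFun u x := by
  have h : ⨍⁻ y in Metric.ball x r, u y ∂volume ≤ maximalFun u x :=
    le_iSup (fun r : {r : ℝ // 0 < r} => ⨍⁻ y in Metric.ball x r, u y ∂volume) ⟨r, hr⟩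
  rw [setLAverage_eq, ENNReal.div_le_iff' (volume_ball_ne_zero x hr) measure_ball_lt_top.ne] at h
  exact h

theorem lt_maximalFun_iff (u : Eucl d → ℝ≥0∞) (x : Eucl d) (t : ℝ≥0∞) :
    t < maximalFun u x ↔
      ∃ r : ℝ, 0 < r ∧ t * volume (Metric.ball x r) < ∫⁻ y in Metric.ball x r, u y := by
  simp only [maximalFun, lt_iSup_iff, setLAverage_eq, Subtype.exists]
  constructor
  · rintro ⟨r, hr, h⟩
    exact ⟨r, hr, (ENNReal.lt_div_iff_mul_lt (.inl (volume_ball_ne_zero x hr))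
      (.inl measure_ball_lt_top.ne)).1 h⟩
  · rintro ⟨r, hr, h⟩
    exact ⟨r, hr, (ENNReal.lt_div_iff_mul_lt (.inl (volume_ball_ne_zero x hr))
      (.inl measure_ball_lt_top.ne)).2 h⟩

theorem volume_ball_eq (x : Eucl d) {r : ℝ} (hr : 0 < r) :
    volume (Metric.ball x r) = ENNReal.ofReal (r ^ d) * volume (Metric.ball (0 : Eucl d) 1) := by
  have := Measure.addHaar_ball_of_pos (volume : Measure (Eucl d)) x hr
  simpa using this

theorem volume_closedBall_eq (x : Eucl d) {r : ℝ} (hr : 0 ≤ r) :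
    volume (Metric.closedBall x r) =
      ENNReal.ofReal (r ^ d) * volume (Metric.ball (0 : Eucl d) 1) := by
  have := Measure.addHaar_closedBall (volume : Measure (Eucl d)) x hr
  simpa using this

theorem isOpen_setOf_lt_maximalFun (u : Eucl d → ℝ≥0∞) (t : ℝ≥0∞) :
    IsOpen {x | t < maximalFun u x} := by
  rw [Metric.isOpen_iff]
  intro x hx
  obtain ⟨r, hr, h⟩ := (lt_maximalFun_iff u x t).1 hx
  -- a slightly larger radius still works at `x`, hence so does it at nearby centres
  have hcont : Filter.Tendsto
      (fun ρ : ℝ => t * (ENNReal.ofReal (ρ ^ d) * volume (Metric.ball (0 : Eucl d) 1)))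
      (nhdsWithin r (Set.Ioi r))
      (nhds (t * (ENNReal.ofReal (r ^ d) * volume (Metric.ball (0 : Eucl d) 1)))) := by
    have ht : t ≠ ∞ := by
      rintro rfl
      exact absurd hx (by simp)
    refine ENNReal.Tendsto.const_mul ?_ (.inr ht)
    refine ENNReal.Tendsto.mul_const ?_ (.inr measure_ball_lt_top.ne)
    have : Continuous fun ρ : ℝ => ENNReal.ofReal (ρ ^ d) :=
      ENNReal.continuous_ofReal.comp (continuous_pow d)
    exact (this.tendsto r).mono_left nhdsWithin_le_nhds
  rw [volume_ball_eq x hr] at h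
  obtain ⟨ρ, hρ, hρr⟩ := ((hcont.eventually_lt_const h).and self_mem_nhdsWithin).exists
  have hρr : r < ρ := hρr
  refine ⟨ρ - r, sub_pos.2 hρr, fun x' hx' => (lt_maximalFun_iff u x' t).2
    ⟨ρ, hr.trans hρr, ?_⟩⟩
  rw [volume_ball_eq x' (hr.trans hρr)]
  refine hρ.trans_le (lintegral_mono_set ?_)
  refine Metric.ball_subset_ball' ?_
  rw [Metric.mem_ball, dist_comm] at hx'
  linarith

theorem measurable_maximalFun (u : Eucl d → ℝ≥0∞) : Measurable (maximalFun u) :=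
  measurable_of_Ioi fun t => (isOpen_setOf_lt_maximalFun u t).measurableSet

/-- The weak-type `(1,1)` bound for the maximal function, by Vitali's covering lemma. -/
theorem mul_volume_lt_maximalFun_le (hd : d ≠ 0) (u : Eucl d → ℝ≥0∞) {t : ℝ≥0∞}
    (ht : t ≠ 0) (ht' : t ≠ ∞) :
    t * volume {x | t < maximalFun u x} ≤ 4 ^ d * ∫⁻ y, u y := by
  by_cases hI : ∫⁻ y, u y = ∞
  · rw [hI, ENNReal.mul_top (by simp)]
    exact le_top
  set S : Set (Eucl d) := {x | t < maximalFun u x} with hS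
  have hex : ∀ x : Eucl d, ∃ r : ℝ, 0 < r ∧
      (x ∈ S → t * volume (Metric.ball x r) < ∫⁻ y in Metric.ball x r, u y) := by
    intro x
    by_cases hx : x ∈ S
    · obtain ⟨r, hr, h⟩ := (lt_maximalFun_iff u x t).1 hx
      exact ⟨r, hr, fun _ => h⟩
    · exact ⟨1, one_pos, fun h => absurd h hx⟩
  choose r hr hru using hex
  set ω : ℝ≥0∞ := volume (Metric.ball (0 : Eucl d) 1) with hω
  have hω0 : ω ≠ 0 := volume_ball_ne_zero 0 one_pos
  have hωt : ω ≠ ∞ := measure_ball_lt_top.ne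
  -- the radii are bounded, because `t ω r ^ d` is at most the integral of `u`
  have hbound : ∀ x ∈ S, r x ≤ max 1 ((∫⁻ y, u y) / (t * ω)).toReal := by
    intro x hx
    by_cases h1 : r x ≤ 1
    · exact h1.trans (le_max_left _ _)
    refine le_trans ?_ (le_max_right _ _)
    have h2 := (hru x hx).le.trans (setLIntegral_le_lintegral _ _)
    rw [volume_ball_eq x (hr x)] at h2
    have h3 : ENNReal.ofReal (r x ^ d) ≤ (∫⁻ y, u y) / (t * ω) := by
      rw [ENNReal.le_div_iff_mul_le (.inl (mul_ne_zero ht hω0))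
        (.inl (ENNReal.mul_ne_top ht' hωt))]
      calc _ = t * (ENNReal.ofReal (r x ^ d) * ω) := by ring
        _ ≤ _ := h2
    have h4 := ENNReal.toReal_mono
      (ENNReal.div_ne_top hI (mul_ne_zero ht hω0)) h3
    rw [ENNReal.toReal_ofReal (by have := hr x; positivity)] at h4
    exact (le_self_pow₀ (not_le.1 h1).le hd).trans h4
  -- Vitali's lemma needs an enlargement factor above `3`; the value `4` gives the constant `4 ^ d`
  obtain ⟨U, hUS, hdisj, hcov⟩ := Vitali.exists_disjoint_subfamily_covering_enlargement_closedBall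
    S (fun x => x) r _ hbound 4 (by norm_num)
  have hdisj' : U.PairwiseDisjoint fun x => Metric.ball x (r x) :=
    hdisj.mono fun x => Metric.ball_subset_closedBall
  have hUc : U.Countable := hdisj'.countable_of_isOpen (fun _ _ => Metric.isOpen_ball)
    fun x _ => ⟨x, Metric.mem_ball_self (hr x)⟩
  have hsub : S ⊆ ⋃ x ∈ U, Metric.closedBall x (4 * r x) := by
    intro x hx
    obtain ⟨b, hb, h⟩ := hcov x hx
    exact Set.mem_biUnion hb (h (Metric.mem_closedBall_self (hr x).le))
  calc t * volume S
      ≤ t * ∑' x : U, volume (Metric.closedBall (x : Eucl d) (4 * r x)) := by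
        gcongr
        exact (measure_mono hsub).trans (measure_biUnion_le _ hUc _)
    _ = 4 ^ d * ∑' x : U, t * volume (Metric.ball (x : Eucl d) (r x)) := by
        rw [← ENNReal.tsum_mul_left, ← ENNReal.tsum_mul_left]
        refine tsum_congr fun x => ?_
        have h4 : ENNReal.ofReal ((4 * r x) ^ d) = 4 ^ d * ENNReal.ofReal (r x ^ d) := by
          rw [mul_pow, ENNReal.ofReal_mul (by positivity), ENNReal.ofReal_pow (by norm_num)]
          norm_num
        rw [volume_closedBall_eq _ (by have := hr x; positivity), volume_ball_eq _ (hr x), h4]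
        ring
    _ ≤ 4 ^ d * ∑' x : U, ∫⁻ y in Metric.ball (x : Eucl d) (r x), u y := by
        gcongr with x
        exact (hru x (hUS x.2)).le
    _ = 4 ^ d * ∫⁻ y in ⋃ x ∈ U, Metric.ball x (r x), u y := by
        rw [lintegral_biUnion hUc (fun _ _ => measurableSet_ball) hdisj']
    _ ≤ 4 ^ d * ∫⁻ y, u y := by
        gcongr
        exact Measure.restrict_le_self

/-- Removing the part of the function below the level `t` costs at most `t`. -/
theorem maximalFun_le_add (u : Eucl d → ℝ≥0∞) (t : ℝ≥0∞) (x : Eucl d) :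
    maximalFun u x ≤ maximalFun ({y | t < u y}.indicator u) x + t := by
  refine iSup_le fun ⟨r, hr⟩ => ?_
  rw [setLAverage_eq, ENNReal.div_le_iff' (volume_ball_ne_zero x hr) measure_ball_lt_top.ne, mul_add]
  calc ∫⁻ y in Metric.ball x r, u y
      ≤ ∫⁻ y in Metric.ball x r, ({y | t < u y}.indicator u y + t) := by
        refine lintegral_mono fun y => ?_
        by_cases h : t < u y
        · simp [Set.indicator, h]
        · simp only [Set.indicator, Set.mem_ofPred_eq, h, if_false, zero_add]
          exact not_lt.1 h
    _ = (∫⁻ y in Metric.ball x r, {y | t < u y}.indicator u y) +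
          volume (Metric.ball x r) * t := by
        rw [lintegral_add_right _ measurable_const]
        simp [mul_comm]
    _ ≤ _ := by
        gcongr
        exact setLIntegral_ball_le_maximalFun _ x hr

/-- Layer-cake formula for a power of an extended nonnegative number. -/
theorem lintegral_Ioi_rpow_sub_one (a : ℝ≥0∞) {p : ℝ} (hp : 0 < p) :
    ∫⁻ t in Set.Ioi (0 : ℝ), (if ENNReal.ofReal t < a then ENNReal.ofReal (t ^ (p - 1)) else 0) =
      a ^ p / ENNReal.ofReal p := by
  have hfin : ∀ r : ℝ, 0 ≤ r → ∫⁻ t in Set.Ioi (0 : ℝ),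
      (if ENNReal.ofReal t < ENNReal.ofReal r then ENNReal.ofReal (t ^ (p - 1)) else 0) =
      ENNReal.ofReal r ^ p / ENNReal.ofReal p := by
    intro r hr
    have h1 : ∫⁻ t in Set.Ioi (0 : ℝ),
        (if ENNReal.ofReal t < ENNReal.ofReal r then ENNReal.ofReal (t ^ (p - 1)) else 0) =
        ∫⁻ t in Set.Ioo (0 : ℝ) r, ENNReal.ofReal (t ^ (p - 1)) := by
      rw [← lintegral_indicator measurableSet_Ioi, ← lintegral_indicator measurableSet_Ioo]
      refine lintegral_congr fun t => ?_
      simp only [Set.indicator, Set.mem_Ioi, Set.mem_Ioo]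
      by_cases h0 : 0 < t
      · simp [h0, ENNReal.ofReal_lt_ofReal_iff_of_nonneg h0.le]
      · simp [h0]
    have hint : IntervalIntegrable (fun t : ℝ => t ^ (p - 1)) volume 0 r :=
      intervalIntegral.intervalIntegrable_rpow' (by linarith)
    have hint' : IntegrableOn (fun t : ℝ => t ^ (p - 1)) (Set.Ioo 0 r) :=
      ((intervalIntegrable_iff_integrableOn_Ioc_of_le hr).1 hint).mono_set Set.Ioo_subset_Ioc_self
    rw [h1, ← ofReal_integral_eq_lintegral_ofReal hint', ← integral_Ioc_eq_integral_Ioo,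
      ← intervalIntegral.integral_of_le hr, integral_rpow (.inl (by linarith)),
      ENNReal.ofReal_div_of_pos (by linarith), ENNReal.ofReal_rpow_of_nonneg hr hp.le]
    · simp [Real.zero_rpow hp.ne']
    · refine (ae_restrict_mem measurableSet_Ioo).mono fun t ht => ?_
      exact Real.rpow_nonneg ht.1.le _
  by_cases ha : a = ∞
  · subst ha
    rw [ENNReal.top_rpow_of_pos hp, ENNReal.top_div_of_ne_top ENNReal.ofReal_ne_top]
    refine ENNReal.eq_top_of_forall_nnreal_le fun M => ?_
    -- comparison with the finite level `r = (p M) ^ (1/p)`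
    have h2 := hfin ((p * M) ^ (1 / p)) (by positivity)
    have h3 : ENNReal.ofReal ((p * M) ^ (1 / p)) ^ p / ENNReal.ofReal p = M := by
      rw [ENNReal.ofReal_rpow_of_nonneg (by positivity) hp.le, ← Real.rpow_mul (by positivity),
        one_div_mul_cancel hp.ne', Real.rpow_one, ← ENNReal.ofReal_div_of_pos hp,
        mul_div_cancel_left₀ _ hp.ne', ENNReal.ofReal_coe_nnreal]
    rw [← h3, ← h2]
    refine lintegral_mono fun t => ?_
    split_ifs <;> simp_all
  · have := hfin a.toReal ENNReal.toReal_nonneg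
    rwa [ENNReal.ofReal_toReal ha] at this

/-- The maximal function is bounded on `L^p` for `p > 1`. -/
theorem exists_lintegral_maximalFun_rpow_le (hd : d ≠ 0) {p : ℝ} (hp : 1 < p) :
    ∃ C : ℝ≥0, ∀ u : Eucl d → ℝ≥0∞, Measurable u →
      ∫⁻ x, maximalFun u x ^ p ≤ C * ∫⁻ x, u x ^ p := by
  have hp0 : 0 < p := by linarith
  have hp1 : 0 < p - 1 := by linarith
  set A : ℝ≥0∞ := ENNReal.ofReal p * (2 * 4 ^ d) * (2 ^ (p - 1) / ENNReal.ofReal (p - 1)) with hA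
  have hAt : A ≠ ∞ := by
    refine ENNReal.mul_ne_top (ENNReal.mul_ne_top ENNReal.ofReal_ne_top ?_) ?_
    · exact ENNReal.mul_ne_top (by simp) (by simp)
    · exact ENNReal.div_ne_top (ENNReal.rpow_ne_top_of_nonneg hp1.le (by simp)) (by simpa using hp)
  refine ⟨A.toNNReal, fun u hu => ?_⟩
  rw [ENNReal.coe_toNNReal hAt]
  have hM := measurable_maximalFun u
  -- weak-type bound for the part of `u` above the level `t / 2`
  have hweak : ∀ t : ℝ, 0 < t → ENNReal.ofReal (t ^ (p - 1)) *
      volume {x | ENNReal.ofReal t < maximalFun u x} ≤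
      (2 * 4 ^ d) * ∫⁻ x, (if ENNReal.ofReal t < 2 * u x then
        ENNReal.ofReal (t ^ (p - 1 - 1)) else 0) * u x := by
    intro t ht
    set τ : ℝ≥0∞ := ENNReal.ofReal t / 2 with hτ
    have hτ2 : 2 * τ = ENNReal.ofReal t := ENNReal.mul_div_cancel (by simp) (by simp)
    have hτ0 : τ ≠ 0 := by
      rw [hτ, ENNReal.div_ne_zero]
      simpa using ht
    have hτt : τ ≠ ∞ := ENNReal.div_ne_top ENNReal.ofReal_ne_top (by simp)
    have hsub : {x | ENNReal.ofReal t < maximalFun u x} ⊆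
        {x | τ < maximalFun ({y | τ < u y}.indicator u) x} := by
      intro x hx
      by_contra hcon
      have h1 := maximalFun_le_add u τ x
      have h2 : maximalFun ({y | τ < u y}.indicator u) x ≤ τ := not_lt.1 hcon
      have h3 : maximalFun u x ≤ ENNReal.ofReal t := by
        rw [← hτ2, two_mul]
        exact h1.trans (by gcongr)
      exact absurd hx (not_lt.2 h3)
    have h1 := mul_volume_lt_maximalFun_le hd ({y | τ < u y}.indicator u) hτ0 hτt
    have h2 : ∀ x, (if ENNReal.ofReal t < 2 * u x then
        ENNReal.ofReal (t ^ (p - 1 - 1)) else 0) * u x =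
        ENNReal.ofReal (t ^ (p - 1 - 1)) * {y | τ < u y}.indicator u x := by
      intro x
      have : ENNReal.ofReal t < 2 * u x ↔ τ < u x := by
        rw [← hτ2]
        exact ENNReal.mul_lt_mul_iff_right (by simp) (by simp)
      by_cases h : τ < u x
      · simp [Set.indicator, this, h]
      · simp [Set.indicator, this, h]
    have h3 : ENNReal.ofReal (t ^ (p - 1)) = 2 * (ENNReal.ofReal (t ^ (p - 1 - 1)) * τ) := by
      rw [mul_left_comm, hτ2, ← ENNReal.ofReal_mul (by positivity)]
      congr 1
      conv_rhs => rw [← Real.rpow_one t, ← Real.rpow_mul ht.le, one_mul, ← Real.rpow_add ht]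
      congr 1
      ring
    calc _ ≤ 2 * (ENNReal.ofReal (t ^ (p - 1 - 1)) * τ) *
            volume {x | τ < maximalFun ({y | τ < u y}.indicator u) x} := by
          rw [h3]
          gcongr
      _ = 2 * ENNReal.ofReal (t ^ (p - 1 - 1)) *
            (τ * volume {x | τ < maximalFun ({y | τ < u y}.indicator u) x}) := by ring
      _ ≤ 2 * ENNReal.ofReal (t ^ (p - 1 - 1)) *
            (4 ^ d * ∫⁻ y, {y | τ < u y}.indicator u y) := by gcongr
      _ = _ := by
          simp_rw [h2]
          rw [lintegral_const_mul _ (hu.indicator (measurableSet_lt measurable_const hu))]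
          ring
  have hlevel : ∀ x, maximalFun u x ^ p = ENNReal.ofReal p * ∫⁻ t in Set.Ioi (0 : ℝ),
      (if ENNReal.ofReal t < maximalFun u x then ENNReal.ofReal (t ^ (p - 1)) else 0) := by
    intro x
    rw [lintegral_Ioi_rpow_sub_one _ hp0,
      ENNReal.mul_div_cancel (by simpa using hp0) ENNReal.ofReal_ne_top]
  have hmeas : ∀ (v : Eucl d → ℝ≥0∞) (a : ℝ), Measurable v →
      Measurable (Function.uncurry fun (x : Eucl d) (t : ℝ) =>
        if ENNReal.ofReal t < v x then ENNReal.ofReal (t ^ a) else 0) := by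
    intro v a hv
    refine Measurable.ite (measurableSet_lt (by fun_prop) (by fun_prop)) (by fun_prop) (by fun_prop)
  calc ∫⁻ x, maximalFun u x ^ p
      = ENNReal.ofReal p * ∫⁻ x, ∫⁻ t in Set.Ioi (0 : ℝ),
          (if ENNReal.ofReal t < maximalFun u x then ENNReal.ofReal (t ^ (p - 1)) else 0) := by
        simp_rw [hlevel]
        rw [lintegral_const_mul]
        exact (hmeas _ _ hM).lintegral_prod_right
    _ = ENNReal.ofReal p * ∫⁻ t in Set.Ioi (0 : ℝ), ENNReal.ofReal (t ^ (p - 1)) *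
          volume {x | ENNReal.ofReal t < maximalFun u x} := by
        rw [lintegral_lintegral_swap (hmeas _ _ hM).aemeasurable]
        congr 1
        refine lintegral_congr fun t => ?_
        rw [← lintegral_indicator_const (measurableSet_lt measurable_const hM)]
        simp only [Set.indicator, Set.mem_ofPred_eq]
    _ ≤ ENNReal.ofReal p * ∫⁻ t in Set.Ioi (0 : ℝ), (2 * 4 ^ d) *
          ∫⁻ x, (if ENNReal.ofReal t < 2 * u x then
            ENNReal.ofReal (t ^ (p - 1 - 1)) else 0) * u x := by
        gcongr ENNReal.ofReal p * ?_
        exact setLIntegral_mono' measurableSet_Ioi fun t ht => hweak t ht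
    _ = ENNReal.ofReal p * (2 * 4 ^ d) * ∫⁻ x, ∫⁻ t in Set.Ioi (0 : ℝ),
          (if ENNReal.ofReal t < 2 * u x then
            ENNReal.ofReal (t ^ (p - 1 - 1)) else 0) * u x := by
        have hm : Measurable (Function.uncurry fun (x : Eucl d) (t : ℝ) =>
            (if ENNReal.ofReal t < 2 * u x then ENNReal.ofReal (t ^ (p - 1 - 1)) else 0) * u x) :=
          (hmeas _ _ (hu.const_mul 2)).mul (hu.comp measurable_fst)
        rw [lintegral_lintegral_swap hm.aemeasurable, lintegral_const_mul _ hm.lintegral_prod_left]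
        ring
    _ = ENNReal.ofReal p * (2 * 4 ^ d) * ∫⁻ x, (2 ^ (p - 1) / ENNReal.ofReal (p - 1)) *
          u x ^ p := by
        congr 1
        refine lintegral_congr fun x => ?_
        have hm : Measurable fun t : ℝ =>
            (if ENNReal.ofReal t < 2 * u x then ENNReal.ofReal (t ^ (p - 1 - 1)) else 0) :=
          (hmeas _ (p - 1 - 1) (hu.const_mul 2)).comp measurable_prodMk_left
        rw [lintegral_mul_const _ hm, lintegral_Ioi_rpow_sub_one _ hp1,
          ENNReal.mul_rpow_of_nonneg _ _ hp1.le]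
        have : u x ^ p = u x ^ (p - 1) * u x := by
          conv_rhs => rw [← ENNReal.rpow_one (u x), ← ENNReal.rpow_mul, one_mul,
            ← ENNReal.rpow_add_of_nonneg _ _ hp1.le zero_le_one]
          ring_nf
        rw [this, ENNReal.div_eq_inv_mul, ENNReal.div_eq_inv_mul]
        ring
    _ = A * ∫⁻ x, u x ^ p := by
        rw [lintegral_const_mul _ (hu.pow_const p), ← mul_assoc]

end Modulation

namespace Modulation

variable {d : ℕ}

/-! ### The Hardy–Littlewood–Sobolev inequality -/

/-- The Riesz kernel `‖z‖ ^ (-γ)` with values in `[0, ∞]`. For `γ ≠ 0` its value at `0` is `0`, as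
`0⁻¹ = 0`; this does not affect integrals, a point having measure zero when `d ≠ 0`. -/
noncomputable def rieszKernel (γ : ℝ) (z : Eucl d) : ℝ≥0∞ := ENNReal.ofReal ((‖z‖ ^ γ)⁻¹)

theorem measurable_rieszKernel (γ : ℝ) : Measurable (rieszKernel γ : Eucl d → ℝ≥0∞) := by
  unfold rieszKernel
  fun_prop

theorem enorm_div_norm_rpow (γ : ℝ) (c : ℂ) (z : Eucl d) :
    ‖c / ((‖z‖ ^ γ : ℝ) : ℂ)‖ₑ = ‖c‖ₑ * rieszKernel γ z := by
  have h : 0 ≤ ‖z‖ ^ γ := by positivity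
  rw [div_eq_mul_inv, enorm_mul, ← Complex.ofReal_inv, rieszKernel, ← ofReal_norm,
    ← ofReal_norm, Complex.norm_real, Real.norm_of_nonneg (inv_nonneg.2 h)]

theorem rieszKernel_le {γ : ℝ} (hγ : 0 ≤ γ) {z : Eucl d} {r : ℝ} (hr : 0 < r) (h : r ≤ ‖z‖) :
    rieszKernel γ z ≤ ENNReal.ofReal ((r ^ γ)⁻¹) := by
  unfold rieszKernel
  gcongr

/-- Covering a region by balls on which the kernel is bounded. -/
theorem setLIntegral_mul_rieszKernel_le_tsum {γ : ℝ} {u : Eucl d → ℝ≥0∞} (hu : Measurable u)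
    (x : Eucl d) {A : Set (Eucl d)} (hA : MeasurableSet A) (r : ℕ → ℝ) (c : ℕ → ℝ≥0∞)
    (h : ∀ y ∈ A, rieszKernel γ (x - y) ≠ 0 →
      ∃ n, y ∈ Metric.ball x (r n) ∧ rieszKernel γ (x - y) ≤ c n) :
    ∫⁻ y in A, u y * rieszKernel γ (x - y) ≤ ∑' n, c n * ∫⁻ y in Metric.ball x (r n), u y := by
  calc ∫⁻ y in A, u y * rieszKernel γ (x - y)
      ≤ ∫⁻ y in A, ∑' n, c n * (Metric.ball x (r n)).indicator u y := by
        refine setLIntegral_mono' hA fun y hy => ?_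
        by_cases h0 : rieszKernel γ (x - y) = 0
        · simp [h0]
        obtain ⟨n, hn, hc⟩ := h y hy h0
        refine le_trans ?_ (ENNReal.le_tsum n)
        rw [Set.indicator_of_mem hn, mul_comm]
        gcongr
    _ ≤ ∫⁻ y, ∑' n, c n * (Metric.ball x (r n)).indicator u y := setLIntegral_le_lintegral _ _
    _ = _ := by
        have hm : ∀ n, Measurable ((Metric.ball x (r n)).indicator u) :=
          fun n => hu.indicator measurableSet_ball
        rw [lintegral_tsum fun n => ((hm n).const_mul _).aemeasurable]
        refine tsum_congr fun n => ?_
        rw [lintegral_const_mul _ (hm n), lintegral_indicator measurableSet_ball]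

theorem tsum_ofReal_mul_pow {a b : ℝ} (ha : 0 ≤ a) (hb : 0 ≤ b) (hb1 : b < 1) :
    ∑' n : ℕ, ENNReal.ofReal (a * b ^ n) = ENNReal.ofReal (a * (1 - b)⁻¹) := by
  rw [← ENNReal.ofReal_tsum_of_nonneg (fun n => by positivity)
    ((summable_geometric_of_lt_one hb hb1).mul_left a), tsum_mul_left,
    tsum_geometric_of_lt_one hb hb1]

/-- The part of the fractional integral near the singularity is controlled by averages, by summing over
dyadic balls; the sum converges because `γ < d`. -/
theorem exists_setLIntegral_ball_mul_rieszKernel_le {γ : ℝ} (hγ₀ : 0 < γ) (hγd : γ < d) :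
    ∃ C : ℝ≥0, ∀ u : Eucl d → ℝ≥0∞, Measurable u → ∀ (x : Eucl d) (R : ℝ) (M : ℝ≥0∞), 0 < R →
      (∀ r : ℝ, 0 < r → ∫⁻ y in Metric.ball x r, u y ≤ volume (Metric.ball x r) * M) →
      ∫⁻ y in Metric.ball x R, u y * rieszKernel γ (x - y) ≤
        C * ENNReal.ofReal (R ^ (d - γ)) * M := by
  set ω : ℝ≥0∞ := volume (Metric.ball (0 : Eucl d) 1) with hω
  have hωt : ω ≠ ∞ := measure_ball_lt_top.ne
  set b : ℝ := (1 / 2) ^ ((d : ℝ) - γ) with hb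
  have hb0 : 0 ≤ b := by positivity
  have hb1 : b < 1 := Real.rpow_lt_one (by norm_num) (by norm_num) (by linarith)
  have hb1' : 0 ≤ (1 - b)⁻¹ := inv_nonneg.2 (by linarith)
  set A : ℝ≥0∞ := ENNReal.ofReal (2 ^ ((d : ℝ) + γ) * (1 - b)⁻¹) * ω with hA
  refine ⟨A.toNNReal, fun u hu x R M hR hM => ?_⟩
  rw [ENNReal.coe_toNNReal (ENNReal.mul_ne_top ENNReal.ofReal_ne_top hωt)]
  have hρ : ∀ n : ℕ, 0 < R * (1 / 2) ^ n := fun n => by positivity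
  have key := setLIntegral_mul_rieszKernel_le_tsum (γ := γ) hu x
    (measurableSet_ball (x := x) (ε := R))
    (fun n => 2 * (R * (1 / 2) ^ n))
    (fun n => ENNReal.ofReal (((R * (1 / 2) ^ n / 2) ^ γ)⁻¹)) ?_
  · refine key.trans ?_
    have hterm : ∀ n : ℕ, ((R * (1 / 2) ^ n / 2) ^ γ)⁻¹ * (2 * (R * (1 / 2) ^ n)) ^ d =
        2 ^ ((d : ℝ) + γ) * R ^ ((d : ℝ) - γ) * b ^ n := by
      intro n
      have e1 : b ^ n = ((1 / 2 : ℝ) ^ n) ^ ((d : ℝ) - γ) := by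
        rw [hb, ← Real.rpow_mul_natCast (by norm_num), mul_comm, Real.rpow_mul (by norm_num),
          Real.rpow_natCast]
      have h2 : (0 : ℝ) < (1 / 2) ^ n := by positivity
      rw [e1, ← Real.rpow_natCast _ d, Real.div_rpow (hρ n).le (by norm_num),
        Real.mul_rpow (by norm_num) (hρ n).le, inv_div, Real.rpow_add (by norm_num), mul_assoc _ _
        (((1 / 2 : ℝ) ^ n) ^ ((d : ℝ) - γ)), ← Real.mul_rpow hR.le h2.le, Real.rpow_sub (hρ n)]
      field_simp
    calc _ ≤ ∑' n : ℕ, ENNReal.ofReal ((2 ^ ((d : ℝ) + γ) * R ^ ((d : ℝ) - γ)) * b ^ n) *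
          (ω * M) := by
          refine ENNReal.tsum_le_tsum fun n => ?_
          rw [← hterm, ENNReal.ofReal_mul (by positivity), mul_assoc]
          gcongr
          refine (hM _ (by positivity)).trans_eq ?_
          rw [volume_ball_eq x (by positivity), mul_assoc]
      _ = _ := by
          rw [ENNReal.tsum_mul_right, tsum_ofReal_mul_pow (by positivity) hb0 hb1,
            ← mul_assoc, mul_right_comm _ _ (ENNReal.ofReal (R ^ ((d : ℝ) - γ))),
            ← ENNReal.ofReal_mul (by positivity)]
          ring_nf
  · intro y hy h0
    have hz : 0 < ‖x - y‖ := by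
      rcases (norm_nonneg (x - y)).eq_or_lt with h | h
      · exact absurd (by simp [rieszKernel, ← h, Real.zero_rpow hγ₀.ne']) h0
      · exact h
    have hyR : ‖x - y‖ < R := by rwa [Metric.mem_ball, dist_comm, dist_eq_norm] at hy
    obtain ⟨n, hn1, hn2⟩ := exists_nat_pow_near_of_lt_one (x := ‖x - y‖ / R) (y := 1 / 2)
      (by positivity) ((div_le_one hR).2 hyR.le) (by norm_num) (by norm_num)
    rw [lt_div_iff₀ hR, pow_succ] at hn1
    rw [div_le_iff₀ hR] at hn2
    refine ⟨n, ?_, rieszKernel_le hγ₀.le (by have := hρ n; positivity) (by nlinarith)⟩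
    rw [Metric.mem_ball, dist_comm, dist_eq_norm]
    have := hρ n
    nlinarith

theorem setLIntegral_le_rpow_mul_measure_rpow {p : ℝ} (hp : 1 < p) {u : Eucl d → ℝ≥0∞}
    (hu : Measurable u) (A : Set (Eucl d)) :
    ∫⁻ y in A, u y ≤ (∫⁻ y, u y ^ p) ^ (1 / p) * volume A ^ (1 - 1 / p) := by
  have hpq : p.HolderConjugate (Real.conjExponent p) := Real.HolderConjugate.conjExponent hp
  have h := ENNReal.lintegral_mul_le_Lp_mul_Lq (volume.restrict A) hpq hu.aemeasurable
    (g := fun _ => 1) aemeasurable_const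
  have e : 1 / Real.conjExponent p = 1 - 1 / p := by
    have := hpq.inv_add_inv_eq_one
    simp only [one_div]
    linarith
  simp only [Pi.mul_apply, mul_one, ENNReal.one_rpow, lintegral_const, one_mul,
    Measure.restrict_apply_univ, e] at h
  refine h.trans ?_
  gcongr
  exact Measure.restrict_le_self

/-- The part of the fractional integral away from the singularity is controlled by the `L^p`
norm, by Hölder's inequality on dyadic balls. -/
theorem exists_setLIntegral_compl_ball_mul_rieszKernel_le {γ p a : ℝ} (hγ₀ : 0 < γ)
    (hp : 1 < p) (ha : 0 < a) (hpa : d * (1 - 1 / p) - γ = -a) :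
    ∃ C : ℝ≥0, ∀ u : Eucl d → ℝ≥0∞, Measurable u → ∀ (x : Eucl d) (R : ℝ), 0 < R →
      ∫⁻ y in (Metric.ball x R)ᶜ, u y * rieszKernel γ (x - y) ≤
        C * ENNReal.ofReal (R ^ (-a)) * (∫⁻ y, u y ^ p) ^ (1 / p) := by
  set ω : ℝ≥0∞ := volume (Metric.ball (0 : Eucl d) 1) with hω
  have hωt : ω ≠ ∞ := measure_ball_lt_top.ne
  set θ : ℝ := 1 - 1 / p with hθ
  have hθ0 : 0 ≤ θ := by
    have : 1 / p ≤ 1 := (div_le_one (by linarith)).2 hp.le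
    linarith
  set b : ℝ := 2 ^ (-a) with hb
  have hb0 : 0 ≤ b := by positivity
  have hb1 : b < 1 := Real.rpow_lt_one_of_one_lt_of_neg (by norm_num) (by linarith)
  have hb1' : 0 ≤ (1 - b)⁻¹ := inv_nonneg.2 (by linarith)
  set A : ℝ≥0∞ := ENNReal.ofReal (2 ^ ((d : ℝ) * θ) * (1 - b)⁻¹) * ω ^ θ with hA
  refine ⟨A.toNNReal, fun u hu x R hR => ?_⟩
  rw [ENNReal.coe_toNNReal (ENNReal.mul_ne_top ENNReal.ofReal_ne_top
    (ENNReal.rpow_ne_top_of_nonneg hθ0 hωt))]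
  set N : ℝ≥0∞ := (∫⁻ y, u y ^ p) ^ (1 / p) with hN
  have hρ : ∀ n : ℕ, 0 < R * 2 ^ n := fun n => by positivity
  have key := setLIntegral_mul_rieszKernel_le_tsum (γ := γ) hu x
    (measurableSet_ball (x := x) (ε := R)).compl
    (fun n => 2 * (R * 2 ^ n))
    (fun n => ENNReal.ofReal (((R * 2 ^ n) ^ γ)⁻¹)) ?_
  · refine key.trans ?_
    have hterm : ∀ n : ℕ, ((R * 2 ^ n) ^ γ)⁻¹ * ((2 * (R * 2 ^ n)) ^ d) ^ θ =
        2 ^ ((d : ℝ) * θ) * R ^ (-a) * b ^ n := by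
      intro n
      have e1 : b ^ n = ((2 : ℝ) ^ n) ^ (-a) := by
        rw [hb, ← Real.rpow_mul_natCast (by norm_num), mul_comm, Real.rpow_mul (by norm_num),
          Real.rpow_natCast]
      have h2 : (0 : ℝ) < 2 ^ n := by positivity
      rw [e1, ← Real.rpow_natCast _ d, ← Real.rpow_mul (by have := hρ n; positivity),
        Real.mul_rpow (by norm_num) (hρ n).le, mul_assoc _ _ (((2 : ℝ) ^ n) ^ (-a)),
        ← Real.mul_rpow hR.le h2.le, ← hpa, Real.rpow_sub (hρ n)]
      field_simp
    calc _ ≤ ∑' n : ℕ, ENNReal.ofReal ((2 ^ ((d : ℝ) * θ) * R ^ (-a)) * b ^ n) *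
          (ω ^ θ * N) := by
          refine ENNReal.tsum_le_tsum fun n => ?_
          rw [← hterm, ENNReal.ofReal_mul (by positivity), mul_assoc]
          gcongr
          refine (setLIntegral_le_rpow_mul_measure_rpow hp hu _).trans_eq ?_
          rw [volume_ball_eq x (by positivity), ENNReal.mul_rpow_of_nonneg _ _ hθ0,
            ENNReal.ofReal_rpow_of_nonneg (by positivity) hθ0, mul_comm, mul_assoc]
      _ = _ := by
          rw [ENNReal.tsum_mul_right, tsum_ofReal_mul_pow (by positivity) hb0 hb1,
            ← mul_assoc, mul_right_comm _ _ (ENNReal.ofReal (R ^ (-a))),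
            ← ENNReal.ofReal_mul (by positivity)]
          ring_nf
  · intro y hy _
    have hyR : R ≤ ‖x - y‖ := by
      rwa [Set.mem_compl_iff, Metric.mem_ball, dist_comm, dist_eq_norm, not_lt] at hy
    obtain ⟨n, hn1, hn2⟩ := exists_nat_pow_near (x := ‖x - y‖ / R) (y := (2 : ℝ))
      ((one_le_div hR).2 hyR) (by norm_num)
    rw [le_div_iff₀ hR] at hn1
    rw [div_lt_iff₀ hR, pow_succ] at hn2
    refine ⟨n, ?_, rieszKernel_le hγ₀.le (hρ n) (by linarith)⟩
    rw [Metric.mem_ball, dist_comm, dist_eq_norm]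
    linarith

/-- Hedberg's pointwise inequality. -/
theorem exists_lintegral_mul_rieszKernel_le {γ p₁ p₂ : ℝ} (hγ₀ : 0 < γ) (hγd : γ < d)
    (hp₁ : 1 < p₁) (hp₁₂ : p₁ < p₂) (hp : 1 / p₁ + γ / d - 1 = 1 / p₂) :
    ∃ C : ℝ≥0, ∀ u : Eucl d → ℝ≥0∞, Measurable u → ∀ x : Eucl d,
      (∫⁻ y, u y ^ p₁) ^ (1 / p₁) ≠ ∞ →
      ∫⁻ y, u y * rieszKernel γ (x - y) ≤
        C * (maximalFun u x ^ (p₁ / p₂) * ((∫⁻ y, u y ^ p₁) ^ (1 / p₁)) ^ (1 - p₁ / p₂)) := by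
  have hd : (0 : ℝ) < d := hγ₀.trans hγd
  have hp₁0 : 0 < p₁ := by linarith
  have hp₂0 : 0 < p₂ := by linarith
  have hθ0 : 0 < p₁ / p₂ := by positivity
  have hθ1 : p₁ / p₂ < 1 := (div_lt_one hp₂0).2 hp₁₂
  have hγ : γ = d * (1 - 1 / p₁ + 1 / p₂) := by
    have : γ / d = 1 - 1 / p₁ + 1 / p₂ := by linarith
    rw [← this]
    field_simp
  obtain ⟨C₁, hC₁⟩ := exists_setLIntegral_ball_mul_rieszKernel_le (d := d) hγ₀ hγd
  obtain ⟨C₂, hC₂⟩ := exists_setLIntegral_compl_ball_mul_rieszKernel_le (d := d) (a := d / p₂)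
    hγ₀ hp₁ (by positivity) (by rw [hγ]; ring)
  -- the summand `1` keeps the constant nonzero, so that the case of an infinite right-hand side
  -- is trivial
  refine ⟨C₁ + C₂ + 1, fun u hu x hNt => ?_⟩
  set N : ℝ≥0∞ := (∫⁻ y, u y ^ p₁) ^ (1 / p₁) with hN
  set A := maximalFun u x with hA
  have hzero : u =ᵐ[volume] 0 → ∫⁻ y, u y * rieszKernel γ (x - y) = 0 := by
    intro h
    refine (lintegral_congr_ae (g := 0) ?_).trans lintegral_zero
    filter_upwards [h] with y hy
    simp [hy]
  by_cases hN0 : N = 0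
  · have h1 : ∫⁻ y, u y ^ p₁ = 0 := by
      have := (ENNReal.rpow_eq_zero_iff_of_pos (by positivity)).1 (hN ▸ hN0)
      exact this
    rw [lintegral_eq_zero_iff (hu.pow_const _)] at h1
    rw [hzero]
    · exact zero_le
    · filter_upwards [h1] with y hy
      exact (ENNReal.rpow_eq_zero_iff_of_pos hp₁0).1 hy
  by_cases hA0 : A = 0
  · rw [hzero]
    · exact zero_le
    · -- every ball around `x` has zero integral
      have h1 : ∀ n : ℕ, ∫⁻ y in Metric.ball x (n + 1 : ℝ), u y = 0 := fun n => by
        have := setLIntegral_ball_le_maximalFun u x (r := (n + 1 : ℝ)) (by positivity)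
        rw [← hA, hA0, mul_zero] at this
        exact le_antisymm this (zero_le)
      have h2 : ∀ n : ℕ, ∀ᵐ y, y ∈ Metric.ball x (n + 1 : ℝ) → u y = 0 := fun n => by
        have := (lintegral_eq_zero_iff hu).1 (h1 n)
        exact (ae_restrict_iff' measurableSet_ball).1 this
      filter_upwards [ae_all_iff.2 h2] with y hy
      obtain ⟨n, hn⟩ := exists_nat_gt (dist y x)
      exact hy n (Metric.mem_ball.2 (by linarith))
  by_cases hAt : A = ∞
  · rw [hAt, ENNReal.top_rpow_of_pos hθ0, ENNReal.top_mul, ENNReal.mul_top]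
    · exact le_top
    · simp
    · exact (ENNReal.rpow_pos (pos_iff_ne_zero.2 hN0) hNt).ne'
  -- the radius balances the two parts of the integral
  have ha : 0 < A.toReal := ENNReal.toReal_pos hA0 hAt
  have hn : 0 < N.toReal := ENNReal.toReal_pos hN0 hNt
  set R : ℝ := (N.toReal / A.toReal) ^ (p₁ / d) with hR
  have hR0 : 0 < R := by positivity
  have hAe : A = ENNReal.ofReal A.toReal := (ENNReal.ofReal_toReal hAt).symm
  have hNe : N = ENNReal.ofReal N.toReal := (ENNReal.ofReal_toReal hNt).symm
  set a := A.toReal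
  set m := N.toReal
  have e1 : R ^ ((d : ℝ) - γ) * a = a ^ (p₁ / p₂) * m ^ (1 - p₁ / p₂) := by
    rw [hR, ← Real.rpow_mul (by positivity)]
    have : p₁ / d * (d - γ) = 1 - p₁ / p₂ := by
      rw [hγ]
      field_simp
      ring
    rw [this, Real.div_rpow hn.le ha.le, Real.rpow_sub ha, Real.rpow_one]
    field_simp
  have e2 : R ^ (-(d / p₂)) * m = a ^ (p₁ / p₂) * m ^ (1 - p₁ / p₂) := by
    rw [hR, ← Real.rpow_mul (by positivity)]
    have : p₁ / d * -(d / p₂) = -(p₁ / p₂) := by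
      field_simp
    rw [this, Real.rpow_neg (by positivity), Real.div_rpow hn.le ha.le, Real.rpow_sub hn,
      Real.rpow_one]
    field_simp
  have e3 : A ^ (p₁ / p₂) * N ^ (1 - p₁ / p₂) =
      ENNReal.ofReal (a ^ (p₁ / p₂) * m ^ (1 - p₁ / p₂)) := by
    rw [hAe, hNe, ENNReal.ofReal_rpow_of_pos ha, ENNReal.ofReal_rpow_of_pos hn,
      ENNReal.ofReal_mul (by positivity)]
  rw [← lintegral_add_compl _ (measurableSet_ball (x := x) (ε := R)), e3]
  have f1 := hC₁ u hu x R A hR0 fun r hr => setLIntegral_ball_le_maximalFun u x hr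
  have f2 := hC₂ u hu x R hR0
  rw [hAe, mul_assoc, ← ENNReal.ofReal_mul (by positivity), e1] at f1
  rw [← hN, hNe, mul_assoc, ← ENNReal.ofReal_mul (by positivity), e2] at f2
  refine (add_le_add f1 f2).trans ?_
  rw [← add_mul]
  gcongr
  push_cast
  exact le_self_add

/-- The Hardy–Littlewood–Sobolev inequality. -/
theorem exists_lintegral_rieszPotential_rpow_le {γ p₁ p₂ : ℝ} (hγ₀ : 0 < γ) (hγd : γ < d)
    (hp₁ : 1 < p₁) (hp₁₂ : p₁ < p₂) (hp : 1 / p₁ + γ / d - 1 = 1 / p₂) :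
    ∃ C : ℝ≥0, ∀ u : Eucl d → ℝ≥0∞, Measurable u →
      (∫⁻ x, (∫⁻ y, u y * rieszKernel γ (x - y)) ^ p₂) ^ (1 / p₂) ≤
        C * (∫⁻ y, u y ^ p₁) ^ (1 / p₁) := by
  have hd : d ≠ 0 := by
    rintro rfl
    simp only [Nat.cast_zero] at hγd
    linarith
  have hp₁0 : 0 < p₁ := by linarith
  have hp₂0 : 0 < p₂ := by linarith
  have hθ1 : p₁ / p₂ < 1 := (div_lt_one hp₂0).2 hp₁₂
  obtain ⟨C₁, hC₁⟩ := exists_lintegral_mul_rieszKernel_le hγ₀ hγd hp₁ hp₁₂ hp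
  obtain ⟨C₂, hC₂⟩ := exists_lintegral_maximalFun_rpow_le hd hp₁
  have hp' : 0 ≤ 1 / p₂ := by positivity
  -- the summand `1` keeps the constant nonzero, for the case of an infinite right-hand side
  refine ⟨C₁ * C₂ ^ (1 / p₂) + 1, fun u hu => ?_⟩
  set N : ℝ≥0∞ := (∫⁻ y, u y ^ p₁) ^ (1 / p₁) with hN
  by_cases hNt : N = ∞
  · rw [hNt, ENNReal.mul_top (by simp)]
    exact le_top
  have hNp : ∫⁻ y, u y ^ p₁ = N ^ p₁ := by
    rw [hN, ← ENNReal.rpow_mul, one_div_mul_cancel hp₁0.ne', ENNReal.rpow_one]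
  calc (∫⁻ x, (∫⁻ y, u y * rieszKernel γ (x - y)) ^ p₂) ^ (1 / p₂)
      ≤ (∫⁻ x, (C₁ * (maximalFun u x ^ (p₁ / p₂) * N ^ (1 - p₁ / p₂))) ^ p₂) ^ (1 / p₂) := by
        gcongr with x
        exact hC₁ u hu x hNt
    _ = (∫⁻ x, (C₁ : ℝ≥0∞) ^ p₂ * N ^ (p₂ - p₁) * maximalFun u x ^ p₁) ^ (1 / p₂) := by
        congr 1
        refine lintegral_congr fun x => ?_
        rw [ENNReal.mul_rpow_of_nonneg _ _ hp₂0.le, ENNReal.mul_rpow_of_nonneg _ _ hp₂0.le,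
          ← ENNReal.rpow_mul, ← ENNReal.rpow_mul, div_mul_cancel₀ _ hp₂0.ne', sub_mul, one_mul,
          div_mul_cancel₀ _ hp₂0.ne']
        ring
    _ ≤ ((C₁ : ℝ≥0∞) ^ p₂ * N ^ (p₂ - p₁) * (C₂ * N ^ p₁)) ^ (1 / p₂) := by
        rw [lintegral_const_mul _ ((measurable_maximalFun u).pow_const _), ← hNp]
        gcongr
        exact hC₂ u hu
    _ = C₁ * (C₂ : ℝ≥0∞) ^ (1 / p₂) * N := by
        have e : (C₁ : ℝ≥0∞) ^ p₂ * N ^ (p₂ - p₁) * (C₂ * N ^ p₁) =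
            (C₁ : ℝ≥0∞) ^ p₂ * C₂ * N ^ p₂ := by
          conv_rhs => rw [← sub_add_cancel p₂ p₁,
            ENNReal.rpow_add_of_nonneg (x := N) _ _ (by linarith) hp₁0.le]
          rw [sub_add_cancel]
          ring
        rw [e, ENNReal.mul_rpow_of_nonneg _ _ hp', ENNReal.mul_rpow_of_nonneg _ _ hp',
          ← ENNReal.rpow_mul, ← ENNReal.rpow_mul, mul_one_div_cancel hp₂0.ne', ENNReal.rpow_one,
          ENNReal.rpow_one]
    _ ≤ _ := by
        rw [ENNReal.coe_add, ENNReal.coe_mul, ENNReal.coe_rpow_of_nonneg _ hp']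
        gcongr
        exact le_self_add

end Modulation

namespace Modulation

variable {d : ℕ}

open FourierTransform

/-! ### Translations and modulations of Schwartz functions -/

theorem iteratedFDeriv_translate (x : Eucl d) (φ : 𝓢(Eucl d, ℂ)) (l : ℕ) (t : Eucl d) :
    iteratedFDeriv ℝ l (translate x φ) t = iteratedFDeriv ℝ l φ (t - x) :=
  iteratedFDeriv_comp_sub l x t

theorem norm_pow_mul_iteratedFDeriv_sub_le (x : Eucl d) (φ : 𝓢(Eucl d, ℂ)) (k l : ℕ)
    (t : Eucl d) :
    ‖t‖ ^ k * ‖iteratedFDeriv ℝ l φ (t - x)‖ ≤ 2 ^ k * (1 + ‖x‖) ^ k *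
      (SchwartzMap.seminorm ℝ k l φ + SchwartzMap.seminorm ℝ 0 l φ) := by
  have h1 : ‖t‖ ^ k ≤ 2 ^ k * (‖t - x‖ ^ k + ‖x‖ ^ k) := by
    calc ‖t‖ ^ k ≤ (‖t - x‖ + ‖x‖) ^ k := by
          gcongr
          simpa using norm_add_le (t - x) x
      _ ≤ 2 ^ (k - 1) * (‖t - x‖ ^ k + ‖x‖ ^ k) := add_pow_le (norm_nonneg _) (norm_nonneg _) k
      _ ≤ _ := by
          gcongr
          · norm_num
          · omega
  have h2 := SchwartzMap.le_seminorm ℝ k l φ (t - x)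
  have h3 := SchwartzMap.norm_iteratedFDeriv_le_seminorm ℝ φ l (t - x)
  have h4 : ‖x‖ ^ k ≤ (1 + ‖x‖) ^ k := by
    gcongr
    linarith
  have h5 : (1 : ℝ) ≤ (1 + ‖x‖) ^ k := one_le_pow₀ (by linarith [norm_nonneg x])
  have h6 : 0 ≤ SchwartzMap.seminorm ℝ k l φ := apply_nonneg _ _
  calc ‖t‖ ^ k * ‖iteratedFDeriv ℝ l φ (t - x)‖
      ≤ 2 ^ k * (‖t - x‖ ^ k + ‖x‖ ^ k) * ‖iteratedFDeriv ℝ l φ (t - x)‖ := by gcongr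
    _ = 2 ^ k * (‖t - x‖ ^ k * ‖iteratedFDeriv ℝ l φ (t - x)‖ +
          ‖x‖ ^ k * ‖iteratedFDeriv ℝ l φ (t - x)‖) := by ring
    _ ≤ 2 ^ k * ((1 + ‖x‖) ^ k * SchwartzMap.seminorm ℝ k l φ +
          (1 + ‖x‖) ^ k * SchwartzMap.seminorm ℝ 0 l φ) := by
        gcongr 2 ^ k * ?_
        exact add_le_add (h2.trans (le_mul_of_one_le_left h6 h5))
          (mul_le_mul h4 h3 (norm_nonneg _) (by positivity))
    _ = _ := by ring

theorem seminorm_translate_le (x : Eucl d) (φ : 𝓢(Eucl d, ℂ)) (k l : ℕ) :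
    SchwartzMap.seminorm ℝ k l (translate x φ) ≤ 2 ^ k * (1 + ‖x‖) ^ k *
      (SchwartzMap.seminorm ℝ k l φ + SchwartzMap.seminorm ℝ 0 l φ) := by
  refine SchwartzMap.seminorm_le_bound ℝ k l _ (by positivity) fun t => ?_
  rw [iteratedFDeriv_translate]
  exact norm_pow_mul_iteratedFDeriv_sub_le x φ k l t

theorem translate_sub (x : Eucl d) (φ ψ : 𝓢(Eucl d, ℂ)) :
    translate x (φ - ψ) = translate x φ - translate x ψ := rfl

theorem translate_translate (x y : Eucl d) (φ : 𝓢(Eucl d, ℂ)) :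
    translate x (translate y φ) = translate (x + y) φ := by
  ext t
  simp [translate_apply, sub_sub]

/-- Translations are locally Lipschitz in the translation vector, for every Schwartz seminorm. -/
theorem seminorm_translate_sub_translate_le (φ : 𝓢(Eucl d, ℂ)) (k l : ℕ) {R : ℝ} {x y : Eucl d}
    (hx : ‖x‖ ≤ R) (hy : ‖y‖ ≤ R) :
    SchwartzMap.seminorm ℝ k l (translate x φ - translate y φ) ≤ 2 ^ k * (1 + R) ^ k *
      (SchwartzMap.seminorm ℝ k (l + 1) φ + SchwartzMap.seminorm ℝ 0 (l + 1) φ) * ‖x - y‖ := by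
  have hR : 0 ≤ R := (norm_nonneg x).trans hx
  set B := SchwartzMap.seminorm ℝ k (l + 1) φ + SchwartzMap.seminorm ℝ 0 (l + 1) φ with hB
  have hB0 : 0 ≤ B := by positivity
  refine SchwartzMap.seminorm_le_bound ℝ k l _ (by positivity) fun t => ?_
  have hsub : iteratedFDeriv ℝ l (translate x φ - translate y φ : 𝓢(Eucl d, ℂ)) t =
      iteratedFDeriv ℝ l φ (t - x) - iteratedFDeriv ℝ l φ (t - y) := by
    rw [← iteratedFDeriv_translate x, ← iteratedFDeriv_translate y]
    exact iteratedFDeriv_sub_apply ((translate x φ).contDiffAt l) ((translate y φ).contDiffAt l)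
  have hdiff : Differentiable ℝ (iteratedFDeriv ℝ l φ) :=
    (φ.smooth (l + 1)).differentiable_iteratedFDeriv (by exact_mod_cast Nat.lt_succ_self l)
  have hd2 : ∀ z, HasFDerivAt (fun z => iteratedFDeriv ℝ l φ (t - z))
      ((fderiv ℝ (iteratedFDeriv ℝ l φ) (t - z)).comp
        (-(ContinuousLinearMap.id ℝ (Eucl d)))) z := fun z =>
    (hdiff (t - z)).hasFDerivAt.comp z ((hasFDerivAt_id z).const_sub t)
  have key : ‖t‖ ^ k * ‖iteratedFDeriv ℝ l φ (t - x) - iteratedFDeriv ℝ l φ (t - y)‖ ≤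
      2 ^ k * (1 + R) ^ k * B * ‖x - y‖ := by
    have h := Convex.norm_image_sub_le_of_norm_fderiv_le (𝕜 := ℝ)
      (f := fun z => ‖t‖ ^ k • iteratedFDeriv ℝ l φ (t - z))
      (C := 2 ^ k * (1 + R) ^ k * B) (s := Metric.closedBall 0 R) (x := y) (y := x)
      (fun z _ => ((hd2 z).fun_const_smul _).differentiableAt) (fun z hz => ?_)
      (convex_closedBall 0 R) (by simpa using hy) (by simpa using hx)
    · rwa [← smul_sub, norm_smul, norm_pow, norm_norm] at h
    · have hz' : ‖z‖ ≤ R := by simpa using hz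
      rw [((hd2 z).fun_const_smul (‖t‖ ^ k)).fderiv, norm_smul, norm_pow, norm_norm]
      calc _ ≤ ‖t‖ ^ k * (‖fderiv ℝ (iteratedFDeriv ℝ l φ) (t - z)‖ * 1) := by
            gcongr
            refine (ContinuousLinearMap.opNorm_comp_le _ _).trans ?_
            gcongr
            rw [norm_neg]
            exact ContinuousLinearMap.norm_id_le
        _ = ‖t‖ ^ k * ‖iteratedFDeriv ℝ (l + 1) φ (t - z)‖ := by
            rw [mul_one, norm_fderiv_iteratedFDeriv]
        _ ≤ 2 ^ k * (1 + ‖z‖) ^ k * B := norm_pow_mul_iteratedFDeriv_sub_le z φ k (l + 1) t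
        _ ≤ _ := by gcongr
  rwa [hsub]

theorem continuous_translate :
    Continuous fun z : Eucl d × 𝓢(Eucl d, ℂ) => translate z.1 z.2 := by
  rw [continuous_iff_continuousAt]
  rintro ⟨x, φ⟩
  refine ((schwartz_withSeminorms ℝ (Eucl d) ℂ).tendsto_nhds _ _).2 ?_
  rintro ⟨k, l⟩ ε hε
  have hbound : ∀ z : Eucl d × 𝓢(Eucl d, ℂ), ‖z.1‖ ≤ ‖x‖ + 1 →
      SchwartzMap.seminorm ℝ k l (translate z.1 z.2 - translate x φ) ≤
        2 ^ k * (1 + (‖x‖ + 1)) ^ k * (SchwartzMap.seminorm ℝ k l (z.2 - φ) +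
          SchwartzMap.seminorm ℝ 0 l (z.2 - φ)) +
        2 ^ k * (1 + (‖x‖ + 1)) ^ k * (SchwartzMap.seminorm ℝ k (l + 1) φ +
          SchwartzMap.seminorm ℝ 0 (l + 1) φ) * ‖z.1 - x‖ := by
    intro z hz
    have e : translate z.1 z.2 - translate x φ =
        translate z.1 (z.2 - φ) + (translate z.1 φ - translate x φ) := by
      rw [translate_sub]
      abel
    rw [e]
    refine (map_add_le_add _ _ _).trans (add_le_add ?_
      (seminorm_translate_sub_translate_le φ k l hz (by linarith)))
    refine (seminorm_translate_le _ _ _ _).trans ?_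
    gcongr
  have hc : ∀ k l, Continuous fun z : Eucl d × 𝓢(Eucl d, ℂ) =>
      SchwartzMap.seminorm ℝ k l (z.2 - φ) := fun k l =>
    ((schwartz_withSeminorms ℝ (Eucl d) ℂ).continuous_seminorm (k, l)).comp
      (continuous_snd.sub continuous_const)
  have hlim : Filter.Tendsto (fun z : Eucl d × 𝓢(Eucl d, ℂ) =>
      2 ^ k * (1 + (‖x‖ + 1)) ^ k * (SchwartzMap.seminorm ℝ k l (z.2 - φ) +
          SchwartzMap.seminorm ℝ 0 l (z.2 - φ)) +
        2 ^ k * (1 + (‖x‖ + 1)) ^ k * (SchwartzMap.seminorm ℝ k (l + 1) φ +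
          SchwartzMap.seminorm ℝ 0 (l + 1) φ) * ‖z.1 - x‖) (nhds (x, φ)) (nhds 0) := by
    have hcont : Continuous (fun z : Eucl d × 𝓢(Eucl d, ℂ) =>
      2 ^ k * (1 + (‖x‖ + 1)) ^ k * (SchwartzMap.seminorm ℝ k l (z.2 - φ) +
          SchwartzMap.seminorm ℝ 0 l (z.2 - φ)) +
        2 ^ k * (1 + (‖x‖ + 1)) ^ k * (SchwartzMap.seminorm ℝ k (l + 1) φ +
          SchwartzMap.seminorm ℝ 0 (l + 1) φ) * ‖z.1 - x‖) :=
      (continuous_const.mul ((hc k l).add (hc 0 l))).add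
        (continuous_const.mul (continuous_fst.sub continuous_const).norm)
    have := hcont.tendsto (x, φ)
    simpa using this
  have hnear : ∀ᶠ z : Eucl d × 𝓢(Eucl d, ℂ) in nhds (x, φ), ‖z.1‖ < ‖x‖ + 1 :=
    (continuous_fst.norm.tendsto (x, φ)).eventually_lt_const (by simp)
  filter_upwards [hnear, hlim.eventually_lt_const hε] with z h1 h2
  exact (hbound z h1.le).trans_lt h2

theorem fourier_modulate (w : Eucl d) (φ : 𝓢(Eucl d, ℂ)) :
    𝓕 (modulate w φ) = translate w (𝓕 φ) := by
  ext ξ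
  rw [translate_apply, SchwartzMap.fourier_coe, SchwartzMap.fourier_coe, Real.fourier_eq',
    Real.fourier_eq']
  refine integral_congr_ae (Filter.Eventually.of_forall fun v => ?_)
  simp only [modulate_apply, character, smul_eq_mul, ← mul_assoc, ← Complex.exp_add]
  congr 2
  rw [inner_sub_right, real_inner_comm v w]
  push_cast
  ring

/-- Modulation is conjugate to translation under the Fourier transform, so that bounds for
translations carry over to modulations. -/
theorem modulate_eq (w : Eucl d) (φ : 𝓢(Eucl d, ℂ)) :
    modulate w φ = 𝓕⁻ (translate w (𝓕 φ)) := by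
  rw [← fourier_modulate]
  simp

theorem continuous_modulate :
    Continuous fun z : Eucl d × 𝓢(Eucl d, ℂ) => modulate z.1 z.2 := by
  simp_rw [modulate_eq]
  exact continuous_fourierInv.comp (continuous_translate.comp
    (continuous_fst.prodMk (continuous_fourier.comp continuous_snd)))

theorem continuous_conjugate : Continuous (conjugate : 𝓢(Eucl d, ℂ) → 𝓢(Eucl d, ℂ)) :=
  (SchwartzMap.postcompCLM (𝕜 := ℝ) (Complex.conjCLE : ℂ →L[ℝ] ℂ)).continuous

theorem continuous_modulate_translate (g : 𝓢(Eucl d, ℂ)) :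
    Continuous fun z : Eucl d × Eucl d => modulate z.2 (translate z.1 g) := by
  have h1 : Continuous fun z : Eucl d × Eucl d => (z.1, g) :=
    continuous_fst.prodMk continuous_const
  have h2 : Continuous fun z : Eucl d × Eucl d => translate z.1 g :=
    continuous_translate.comp h1
  have h3 : Continuous fun z : Eucl d × Eucl d => (z.2, translate z.1 g) :=
    continuous_snd.prodMk h2
  have h4 := Continuous.comp (continuous_modulate (d := d)) h3
  simpa only [Function.comp_def] using h4

theorem continuous_stft (g : 𝓢(Eucl d, ℂ)) (f : 𝓢'(Eucl d, ℂ)) :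
    Continuous fun z : Eucl d × Eucl d => stft g f z.1 z.2 := by
  have h : Continuous fun z : Eucl d × Eucl d => conjugate (modulate z.2 (translate z.1 g)) :=
    continuous_conjugate.comp (continuous_modulate_translate g)
  exact f.continuous.comp h

/-- A family of Schwartz functions whose seminorms are all bounded by powers of a weight. -/
def SlowlyGrowing {Z : Type*} (ν : Z → ℝ) (Φ : Z → 𝓢(Eucl d, ℂ)) : Prop :=
  ∀ k l : ℕ, ∃ (C : ℝ) (N : ℕ), 0 ≤ C ∧ ∀ z, SchwartzMap.seminorm ℝ k l (Φ z) ≤ C * ν z ^ N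

namespace SlowlyGrowing

variable {Z : Type*} {ν : Z → ℝ} {Φ : Z → 𝓢(Eucl d, ℂ)}

theorem const (φ : 𝓢(Eucl d, ℂ)) : SlowlyGrowing ν fun _ => φ := fun k l =>
  ⟨SchwartzMap.seminorm ℝ k l φ, 0, apply_nonneg _ _, fun z => by simp⟩

theorem finset_sup (h : SlowlyGrowing ν Φ) (hν : ∀ z, 1 ≤ ν z) (s : Finset (ℕ × ℕ)) :
    ∃ (C : ℝ) (N : ℕ), 0 ≤ C ∧
      ∀ z, (s.sup (schwartzSeminormFamily ℝ (Eucl d) ℂ)) (Φ z) ≤ C * ν z ^ N := by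
  choose C N hC h using h
  refine ⟨∑ i ∈ s, C i.1 i.2, ∑ i ∈ s, N i.1 i.2, Finset.sum_nonneg fun i _ => hC _ _,
    fun z => ?_⟩
  have hz : 0 ≤ ν z := zero_le_one.trans (hν z)
  refine Seminorm.finset_sup_apply_le (mul_nonneg (Finset.sum_nonneg fun i _ => hC _ _)
    (pow_nonneg hz _)) fun i hi => ?_
  refine (h i.1 i.2 z).trans ?_
  gcongr
  · exact Finset.sum_nonneg fun i _ => hC _ _
  · exact Finset.single_le_sum (f := fun i : ℕ × ℕ => C i.1 i.2) (fun i _ => hC _ _) hi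
  · exact hν z
  · exact Finset.single_le_sum (f := fun i : ℕ × ℕ => N i.1 i.2) (fun i _ => Nat.zero_le _) hi

theorem clm (h : SlowlyGrowing ν Φ) (hν : ∀ z, 1 ≤ ν z) (A : 𝓢(Eucl d, ℂ) →L[ℝ] 𝓢(Eucl d, ℂ)) :
    SlowlyGrowing ν fun z => A (Φ z) := by
  intro k l
  obtain ⟨s, D, -, hD⟩ := Seminorm.bound_of_continuous (schwartz_withSeminorms ℝ (Eucl d) ℂ)
    ((schwartzSeminormFamily ℝ (Eucl d) ℂ (k, l)).comp A.toLinearMap)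
    (((schwartz_withSeminorms ℝ (Eucl d) ℂ).continuous_seminorm (k, l)).comp A.continuous)
  obtain ⟨C, N, hC, hs⟩ := h.finset_sup hν s
  refine ⟨D * C, N, by positivity, fun z => (hD (Φ z)).trans ?_⟩
  rw [mul_assoc]
  exact mul_le_mul_of_nonneg_left (hs z) D.2

theorem translate (h : SlowlyGrowing ν Φ) (hν : ∀ z, 1 ≤ ν z) (x : Z → Eucl d)
    (hx : ∀ z, 1 + ‖x z‖ ≤ ν z) : SlowlyGrowing ν fun z => Modulation.translate (x z) (Φ z) := by
  intro k l
  obtain ⟨C, N, hC, h1⟩ := h k l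
  obtain ⟨C', N', hC', h2⟩ := h 0 l
  refine ⟨2 ^ k * (C + C'), k + (N + N'), by positivity, fun z => ?_⟩
  have hz : 0 ≤ ν z := zero_le_one.trans (hν z)
  refine (seminorm_translate_le _ _ _ _).trans ?_
  calc _ ≤ 2 ^ k * ν z ^ k * (C * ν z ^ (N + N') + C' * ν z ^ (N + N')) := by
        gcongr
        · exact hx z
        · refine (h1 z).trans ?_
          gcongr
          · exact hν z
          · omega
        · refine (h2 z).trans ?_
          gcongr
          · exact hν z
          · omega
    _ = _ := by ring

theorem modulate (h : SlowlyGrowing ν Φ) (hν : ∀ z, 1 ≤ ν z) (w : Z → Eucl d)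
    (hw : ∀ z, 1 + ‖w z‖ ≤ ν z) : SlowlyGrowing ν fun z => Modulation.modulate (w z) (Φ z) := by
  simp_rw [modulate_eq]
  exact ((h.clm hν (fourierCLM ℝ 𝓢(Eucl d, ℂ))).translate hν w hw).clm hν
    (fourierInvCLM ℝ 𝓢(Eucl d, ℂ))

end SlowlyGrowing

end Modulation

namespace Modulation

/-! ### Tempered distributions and integrals of Schwartz functions -/

open scoped BoundedContinuousFunction ContDiff

section superposition

variable {E F : Type*} [NormedAddCommGroup E] [NormedSpace ℝ E] [NormedAddCommGroup F]
  [NormedSpace ℝ F]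

/-- The normed space of continuous `l`-linear maps. The type synonym gives bounded continuous
functions with values in it a single path to their normed structure. -/
def MultilinearSpace (E F : Type*) [NormedAddCommGroup E] [NormedSpace ℝ E]
    [NormedAddCommGroup F] [NormedSpace ℝ F] (l : ℕ) : Type _ :=
  ContinuousMultilinearMap ℝ (fun _ : Fin l => E) F

namespace MultilinearSpace

variable (l : ℕ)

noncomputable instance : NormedAddCommGroup (MultilinearSpace E F l) :=
  inferInstanceAs (NormedAddCommGroup (ContinuousMultilinearMap ℝ (fun _ : Fin l => E) F))

noncomputable instance : NormedSpace ℝ (MultilinearSpace E F l) :=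
  inferInstanceAs (NormedSpace ℝ (ContinuousMultilinearMap ℝ (fun _ : Fin l => E) F))

noncomputable instance [NormedSpace ℂ F] [SMulCommClass ℝ ℂ F] :
    NormedSpace ℂ (MultilinearSpace E F l) :=
  inferInstanceAs (NormedSpace ℂ (ContinuousMultilinearMap ℝ (fun _ : Fin l => E) F))

instance [CompleteSpace F] : CompleteSpace (MultilinearSpace E F l) :=
  inferInstanceAs (CompleteSpace (ContinuousMultilinearMap ℝ (fun _ : Fin l => E) F))

end MultilinearSpace

/-- The function `x ↦ ‖x‖ ^ k • D^l φ (x)`. -/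
noncomputable def weightedDeriv (k l : ℕ) (φ : 𝓢(E, F)) (x : E) : MultilinearSpace E F l :=
  (‖x‖ ^ k • iteratedFDeriv ℝ l φ x : ContinuousMultilinearMap ℝ (fun _ : Fin l => E) F)

theorem continuous_weightedDeriv (k l : ℕ) (φ : 𝓢(E, F)) : Continuous (weightedDeriv k l φ) :=
  (continuous_norm.pow k).smul ((φ.smooth l).continuous_iteratedFDeriv le_rfl)

theorem norm_weightedDeriv (k l : ℕ) (φ : 𝓢(E, F)) (x : E) :
    ‖weightedDeriv k l φ x‖ = ‖x‖ ^ k * ‖iteratedFDeriv ℝ l φ x‖ := by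
  have : ‖(‖x‖ ^ k • iteratedFDeriv ℝ l φ x)‖ = ‖x‖ ^ k * ‖iteratedFDeriv ℝ l φ x‖ := by
    rw [norm_smul, norm_pow, norm_norm]
  exact this

theorem weightedDeriv_add (k l : ℕ) (φ ψ : 𝓢(E, F)) (x : E) :
    weightedDeriv k l (φ + ψ) x = weightedDeriv k l φ x + weightedDeriv k l ψ x := by
  change ‖x‖ ^ k • iteratedFDeriv ℝ l (φ + ψ : 𝓢(E, F)) x =
    ‖x‖ ^ k • iteratedFDeriv ℝ l φ x + ‖x‖ ^ k • iteratedFDeriv ℝ l ψ x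
  rw [← smul_add]
  congr 1
  exact iteratedFDeriv_add_apply (φ.contDiffAt l) (ψ.contDiffAt l)

variable [NormedSpace ℂ F] [SMulCommClass ℝ ℂ F]

theorem weightedDeriv_smul (k l : ℕ) (c : ℂ) (φ : 𝓢(E, F)) (x : E) :
    weightedDeriv k l (c • φ) x = c • weightedDeriv k l φ x := by
  have h : iteratedFDeriv ℝ l (c • φ : 𝓢(E, F)) x = c • iteratedFDeriv ℝ l φ x :=
    iteratedFDeriv_const_smul_apply (φ.contDiffAt l)
  change ‖x‖ ^ k • iteratedFDeriv ℝ l (c • φ : 𝓢(E, F)) x =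
    c • ‖x‖ ^ k • iteratedFDeriv ℝ l φ x
  rw [h, smul_comm]

/-- The map `φ ↦ (x ↦ ‖x‖ ^ k • D^l φ (x))` from Schwartz functions to bounded continuous
functions. Its sup norm is the Schwartz seminorm with indices `k`, `l`. -/
noncomputable def weightedDerivCLM (k l : ℕ) : 𝓢(E, F) →L[ℂ] (E →ᵇ MultilinearSpace E F l) :=
  SchwartzMap.mkCLMtoNormedSpace (𝕜 := ℂ) (σ := RingHom.id ℂ)
    (fun φ : 𝓢(E, F) => BoundedContinuousFunction.ofNormedAddCommGroup
      (weightedDeriv k l φ) (continuous_weightedDeriv k l φ)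
      (SchwartzMap.seminorm ℂ k l φ) (fun x =>
        (norm_weightedDeriv k l φ x).trans_le (SchwartzMap.le_seminorm ℂ k l φ x)))
    (fun φ ψ => by
      ext1 x
      exact weightedDeriv_add k l φ ψ x)
    (fun c φ => by
      ext1 x
      exact weightedDeriv_smul k l c φ x)
    ⟨{(k, l)}, 1, zero_le_one, fun φ => by
      rw [Finset.sup_singleton, one_mul]
      exact BoundedContinuousFunction.norm_ofNormedAddCommGroup_le _ (apply_nonneg _ _) _⟩

theorem norm_weightedDerivCLM (k l : ℕ) (φ : 𝓢(E, F)) :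
    ‖weightedDerivCLM k l φ‖ = SchwartzMap.seminorm ℝ k l φ := by
  refine le_antisymm ?_ ?_
  · refine (BoundedContinuousFunction.norm_le (apply_nonneg _ _)).2 fun x => ?_
    exact (norm_weightedDeriv k l φ x).trans_le (SchwartzMap.le_seminorm ℝ k l φ x)
  · refine SchwartzMap.seminorm_le_bound ℝ k l φ (norm_nonneg _) fun x => ?_
    exact (norm_weightedDeriv k l φ x).symm.trans_le ((weightedDerivCLM k l φ).norm_coe_le_norm x)

/-- The weighted derivatives with indices in a finite set, as a map to a Banach space. -/
noncomputable def weightedDerivsCLM (s : Finset (ℕ × ℕ)) :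
    𝓢(E, F) →L[ℂ] (∀ i : s, E →ᵇ MultilinearSpace E F i.1.2) :=
  ContinuousLinearMap.pi fun i => weightedDerivCLM i.1.1 i.1.2

/-- A continuous functional bounded by the norm of a continuous linear map factors through it, by
the Hahn–Banach theorem. -/
theorem exists_strongDual_comp_eq {V B : Type*} [AddCommGroup V] [Module ℂ V]
    [NormedAddCommGroup B] [NormedSpace ℂ B] (J : V →ₗ[ℂ] B) (f : V →ₗ[ℂ] ℂ) (C : ℝ)
    (h : ∀ v, ‖f v‖ ≤ C * ‖J v‖) : ∃ L : StrongDual ℂ B, ∀ v, f v = L (J v) := by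
  have hker : J.ker ≤ f.ker := by
    intro v hv
    have h0 : J v = 0 := hv
    have := h v
    rw [h0, norm_zero, mul_zero] at this
    exact norm_le_zero_iff.1 this
  let M : J.range →ₗ[ℂ] ℂ := (J.ker.liftQ f hker).comp J.quotKerEquivRange.symm.toLinearMap
  have hM : ∀ (v : V) (hv : J v ∈ J.range), M ⟨J v, hv⟩ = f v := by
    intro v hv
    change J.ker.liftQ f hker (J.quotKerEquivRange.symm ⟨J v, hv⟩) = f v
    rw [LinearMap.quotKerEquivRange_symm_apply_image J v hv]
    rfl
  have hMb : ∀ b, ‖M b‖ ≤ C * ‖b‖ := by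
    rintro ⟨_, v, rfl⟩
    exact (congrArg norm (hM v ⟨v, rfl⟩)).trans_le (h v)
  obtain ⟨L, hL, -⟩ := exists_extension_norm_eq J.range (M.mkContinuous C hMb)
  exact ⟨L, fun v => (hM v ⟨v, rfl⟩).symm.trans (hL ⟨J v, v, rfl⟩).symm⟩

/-- A continuous functional on Schwartz space depends continuously on finitely many weighted
derivatives. -/
theorem exists_apply_eq_weightedDerivsCLM (f : 𝓢(E, F) →L[ℂ] ℂ) :
    ∃ (s : Finset (ℕ × ℕ)) (L : StrongDual ℂ (∀ i : s, E →ᵇ MultilinearSpace E F i.1.2)),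
      ∀ φ, f φ = L (weightedDerivsCLM s φ) := by
  obtain ⟨s, C, -, hC⟩ := Seminorm.bound_of_continuous (schwartz_withSeminorms ℂ E F)
    ((normSeminorm ℂ ℂ).comp f.toLinearMap) (continuous_norm.comp f.continuous)
  refine ⟨s, exists_strongDual_comp_eq (weightedDerivsCLM s).toLinearMap f.toLinearMap C
    fun φ => ?_⟩
  refine (hC φ).trans (mul_le_mul_of_nonneg_left ?_ C.2)
  refine Seminorm.finset_sup_apply_le (norm_nonneg _) fun i hi => ?_
  refine le_trans (le_of_eq ?_) (norm_le_pi_norm (weightedDerivsCLM s φ) ⟨i, hi⟩)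
  exact (norm_weightedDerivCLM i.1 i.2 φ).symm

variable {Z : Type*} [TopologicalSpace Z] [SecondCountableTopology Z] [MeasurableSpace Z]
  [OpensMeasurableSpace Z] {μ : Measure Z} {Ψ : Z → 𝓢(E, F)} {φ : 𝓢(E, F)}

theorem integrable_weightedDerivCLM (hΨ : Continuous Ψ)
    (hint : ∀ k l, Integrable (fun z => SchwartzMap.seminorm ℝ k l (Ψ z)) μ) (k l : ℕ) :
    Integrable (fun z => weightedDerivCLM k l (Ψ z)) μ :=
  (hint k l).mono' ((weightedDerivCLM k l).continuous.comp hΨ).aestronglyMeasurable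
    (.of_forall fun z => (norm_weightedDerivCLM k l (Ψ z)).le)

theorem integrable_iteratedFDeriv (hΨ : Continuous Ψ)
    (hint : ∀ k l, Integrable (fun z => SchwartzMap.seminorm ℝ k l (Ψ z)) μ) (l : ℕ) (x : E) :
    Integrable (fun z => iteratedFDeriv ℝ l (Ψ z) x) μ := by
  have h : Integrable (fun z => weightedDeriv 0 l (Ψ z) x) μ :=
    (BoundedContinuousFunction.evalCLM ℝ x).integrable_comp
      (integrable_weightedDerivCLM hΨ hint 0 l)
  have h' : Integrable (fun z => ‖x‖ ^ 0 • iteratedFDeriv ℝ l (Ψ z) x) μ := h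
  simpa using h'

variable [CompleteSpace F]

/-- Differentiation under the integral sign for an integral of Schwartz functions. -/
theorem iteratedFDeriv_eq_integral (hΨ : Continuous Ψ)
    (hint : ∀ k l, Integrable (fun z => SchwartzMap.seminorm ℝ k l (Ψ z)) μ)
    (hφ : ∀ t, φ t = ∫ z, Ψ z t ∂μ) (l : ℕ) (x : E) :
    iteratedFDeriv ℝ l φ x = ∫ z, iteratedFDeriv ℝ l (Ψ z) x ∂μ := by
  set P : E → FormalMultilinearSeries ℝ E F :=
    fun x m => ∫ z, iteratedFDeriv ℝ m (Ψ z) x ∂μ with hP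
  have hderiv : ∀ (m : ℕ) (x : E),
      HasFDerivAt (fun x => P x m) (P x (m + 1)).curryLeft x := by
    intro m x
    let Q : ∀ m : ℕ, E → Z → MultilinearSpace E F m := fun m y z => iteratedFDeriv ℝ m (Ψ z) y
    have hQ : ∀ m y, Integrable (Q m y) μ := fun m y => integrable_iteratedFDeriv hΨ hint m y
    let A : MultilinearSpace E F (m + 1) →L[ℝ] (E →L[ℝ] MultilinearSpace E F m) :=
      (continuousMultilinearCurryLeftEquiv ℝ (fun _ : Fin (m + 1) => E)
        F).toContinuousLinearEquiv.toContinuousLinearMap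
    have hA : ∀ v, ‖A v‖ = ‖v‖ := (continuousMultilinearCurryLeftEquiv ℝ
      (fun _ : Fin (m + 1) => E) F).norm_map
    have key : HasFDerivAt (fun y => ∫ z, Q m y z ∂μ) (A (∫ z, Q (m + 1) x z ∂μ)) x := by
      rw [← A.integral_comp_comm (hQ (m + 1) x)]
      refine hasFDerivAt_integral_of_dominated_of_fderiv_le (s := Set.univ)
        (F' := fun y z => A (Q (m + 1) y z))
        (bound := fun z => SchwartzMap.seminorm ℝ 0 (m + 1) (Ψ z)) Filter.univ_mem
        (.of_forall fun y => (hQ m y).aestronglyMeasurable) (hQ m x)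
        (A.integrable_comp (hQ (m + 1) x)).aestronglyMeasurable
        (.of_forall fun z y _ => ?_) (hint 0 (m + 1)) (.of_forall fun z y _ => ?_)
      · rw [hA]
        exact SchwartzMap.norm_iteratedFDeriv_le_seminorm ℝ (Ψ z) (m + 1) y
      · have hd : DifferentiableAt ℝ (iteratedFDeriv ℝ m (Ψ z)) y :=
          ((Ψ z).smooth (m + 1)).differentiable_iteratedFDeriv
            (by exact_mod_cast Nat.lt_succ_self m) y
        have h2 := hd.hasFDerivAt
        rw [fderiv_iteratedFDeriv] at h2
        exact h2
    exact key
  have hT : HasFTaylorSeriesUpTo (l : WithTop ℕ∞) φ P := by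
    refine ⟨fun y => ?_, fun m _ y => hderiv m y, fun m _ => ?_⟩
    · have hI := integrable_iteratedFDeriv hΨ hint 0 y
      let A := (continuousMultilinearCurryFin0 ℝ E F).toContinuousLinearEquiv.toContinuousLinearMap
      have e : (P y 0).curry0 = ∫ z, (iteratedFDeriv ℝ 0 (Ψ z) y).curry0 ∂μ :=
        (A.integral_comp_comm hI).symm
      rw [e, hφ y]
      rfl
    · exact continuous_iff_continuousAt.2 fun y => (hderiv m y).continuousAt
  exact (hT.eq_iteratedFDeriv le_rfl x).symm

/-- A continuous functional on Schwartz space commutes with an absolutely convergent integral of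
Schwartz functions. -/
theorem apply_eq_integral (f : 𝓢(E, F) →L[ℂ] ℂ) (hΨ : Continuous Ψ)
    (hint : ∀ k l, Integrable (fun z => SchwartzMap.seminorm ℝ k l (Ψ z)) μ)
    (hφ : ∀ t, φ t = ∫ z, Ψ z t ∂μ) :
    f φ = ∫ z, f (Ψ z) ∂μ := by
  obtain ⟨s, L, hL⟩ := exists_apply_eq_weightedDerivsCLM f
  have hJ : Integrable (fun z => weightedDerivsCLM s (Ψ z)) μ :=
    Integrable.of_eval fun i => integrable_weightedDerivCLM hΨ hint i.1.1 i.1.2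
  have key : weightedDerivsCLM s φ = ∫ z, weightedDerivsCLM s (Ψ z) ∂μ := by
    funext i
    rw [eval_integral fun i => integrable_weightedDerivCLM hΨ hint i.1.1 i.1.2]
    ext1 x
    have e := (BoundedContinuousFunction.evalCLM ℝ x).integral_comp_comm
      (integrable_weightedDerivCLM hΨ hint i.1.1 i.1.2)
    refine Eq.trans ?_ e
    have h2 : ‖x‖ ^ i.1.1 • iteratedFDeriv ℝ i.1.2 φ x =
        ∫ z, ‖x‖ ^ i.1.1 • iteratedFDeriv ℝ i.1.2 (Ψ z) x ∂μ := by
      rw [iteratedFDeriv_eq_integral hΨ hint hφ, ← integral_smul]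
    exact h2
  rw [hL, key, ← L.integral_comp_comm hJ]
  exact integral_congr_ae (.of_forall fun z => (hL (Ψ z)).symm)

end superposition

end Modulation

namespace Modulation

variable {d : ℕ}

/-! ### The inversion formula for the short-time Fourier transform -/

open FourierTransform

/-- A continuous seminorm that controls polynomial decay of order `K`. -/
noncomputable def decaySeminorm (K : ℕ) : Seminorm ℂ 𝓢(Eucl d, ℂ) :=
  (2 ^ K : ℝ≥0) • (SchwartzMap.seminorm ℂ K 0 + SchwartzMap.seminorm ℂ 0 0)

theorem continuous_decaySeminorm (K : ℕ) :
    Continuous (decaySeminorm K : Seminorm ℂ 𝓢(Eucl d, ℂ)) := by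
  have h := (schwartz_withSeminorms ℂ (Eucl d) ℂ).continuous_seminorm
  exact ((h (K, 0)).add (h (0, 0))).const_smul (2 ^ K : ℝ≥0)

theorem one_add_norm_pow_mul_norm_le (K : ℕ) (φ : 𝓢(Eucl d, ℂ)) (t : Eucl d) :
    (1 + ‖t‖) ^ K * ‖φ t‖ ≤ decaySeminorm K φ := by
  have h1 : (1 + ‖t‖) ^ K ≤ 2 ^ K * (1 + ‖t‖ ^ K) := by
    refine (add_pow_le zero_le_one (norm_nonneg t) K).trans ?_
    rw [one_pow]
    gcongr
    · norm_num
    · omega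
  have h2 := SchwartzMap.norm_pow_mul_le_seminorm ℂ φ K t
  have h3 := SchwartzMap.norm_le_seminorm ℂ φ t
  have e : decaySeminorm K φ =
      2 ^ K * (SchwartzMap.seminorm ℂ K 0 φ + SchwartzMap.seminorm ℂ 0 0 φ) := by
    change ((2 ^ K : ℝ≥0) : ℝ) * _ = _
    push_cast
    rfl
  rw [e]
  calc _ ≤ 2 ^ K * (1 + ‖t‖ ^ K) * ‖φ t‖ := by gcongr
    _ = 2 ^ K * (‖t‖ ^ K * ‖φ t‖ + ‖φ t‖) := by ring
    _ ≤ _ := by gcongr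

theorem integrable_one_add_norm_pow_inv :
    Integrable fun t : Eucl d => ((1 + ‖t‖) ^ (d + 1))⁻¹ := by
  have h := integrable_one_add_norm (E := Eucl d) (μ := volume) (r := (d : ℝ) + 1) (by simp)
  refine h.congr (.of_forall fun t => ?_)
  have : (0 : ℝ) ≤ 1 + ‖t‖ := by positivity
  simp only [Real.rpow_neg this]
  rw [← Nat.cast_add_one, Real.rpow_natCast]

/-- If `χ` is bounded by the translate of `ψ` by `x`, then its pairing with `φ` decays in `x`. -/
theorem norm_integral_mul_mul_pow_le (K : ℕ) (φ ψ : 𝓢(Eucl d, ℂ)) (χ : Eucl d → ℂ) (x : Eucl d)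
    (hχ : ∀ t, ‖χ t‖ ≤ ‖ψ (t - x)‖) :
    ‖∫ t, φ t * χ t‖ * (1 + ‖x‖) ^ K ≤ (∫ t : Eucl d, ((1 + ‖t‖) ^ (d + 1))⁻¹) *
      decaySeminorm (K + (d + 1)) φ * decaySeminorm K ψ := by
  have hx : (0 : ℝ) ≤ (1 + ‖x‖) ^ K := by positivity
  have e : ‖∫ t, φ t * χ t‖ * (1 + ‖x‖) ^ K = ‖∫ t, (1 + ‖x‖) ^ K • (φ t * χ t)‖ := by
    rw [integral_smul, norm_smul, Real.norm_of_nonneg hx, mul_comm]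
  rw [e, mul_assoc, ← integral_mul_const]
  refine norm_integral_le_of_norm_le (integrable_one_add_norm_pow_inv.mul_const _)
    (.of_forall fun t => ?_)
  rw [norm_smul, Real.norm_of_nonneg hx, norm_mul]
  have h1 : 1 + ‖x‖ ≤ (1 + ‖t‖) * (1 + ‖t - x‖) := by
    have : ‖x‖ ≤ ‖t‖ + ‖t - x‖ := by
      have := norm_sub_le t (t - x)
      rwa [sub_sub_cancel] at this
    nlinarith [norm_nonneg t, norm_nonneg (t - x), mul_nonneg (norm_nonneg t)
      (norm_nonneg (t - x))]
  have h2 := one_add_norm_pow_mul_norm_le (K + (d + 1)) φ t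
  have h3 := one_add_norm_pow_mul_norm_le K ψ (t - x)
  have ht : (0 : ℝ) < (1 + ‖t‖) ^ (d + 1) := by positivity
  rw [inv_mul_eq_div, le_div_iff₀ ht]
  calc (1 + ‖x‖) ^ K * (‖φ t‖ * ‖χ t‖) * (1 + ‖t‖) ^ (d + 1)
      ≤ ((1 + ‖t‖) * (1 + ‖t - x‖)) ^ K * (‖φ t‖ * ‖ψ (t - x)‖) * (1 + ‖t‖) ^ (d + 1) := by
        gcongr
        exact hχ t
    _ = ((1 + ‖t‖) ^ (K + (d + 1)) * ‖φ t‖) * ((1 + ‖t - x‖) ^ K * ‖ψ (t - x)‖) := by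
        rw [mul_pow, pow_add]
        ring
    _ ≤ _ := by gcongr

theorem norm_character (w t : Eucl d) : ‖character w t‖ = 1 := by
  rw [character, Complex.norm_exp_ofReal_mul_I]

/-- The coefficient `∫ φ(t) g(t - x) exp (2πi ⟨w, t⟩) dt` of a Schwartz function in the inversion
formula for the short-time Fourier transform. -/
noncomputable def synthesisCoeff (g φ : 𝓢(Eucl d, ℂ)) (x w : Eucl d) : ℂ :=
  ∫ t, φ t * modulate w (translate x g) t

theorem continuous_synthesisCoeff (g φ : 𝓢(Eucl d, ℂ)) :
    Continuous fun z : Eucl d × Eucl d => synthesisCoeff g φ z.1 z.2 := by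
  have h := ((toTemperedDistributionCLM (Eucl d) ℂ volume φ).continuous).comp
    (continuous_modulate_translate g)
  refine h.congr fun z => ?_
  refine (toTemperedDistributionCLM_apply_apply volume φ _).trans ?_
  simp only [synthesisCoeff, smul_eq_mul, mul_comm]

theorem norm_synthesisCoeff_translate (g φ : 𝓢(Eucl d, ℂ)) (y x w : Eucl d) :
    ‖synthesisCoeff g (translate y φ) x w‖ = ‖synthesisCoeff g φ (x - y) w‖ := by
  have h : synthesisCoeff g (translate y φ) x w =
      character w y * synthesisCoeff g φ (x - y) w := by
    rw [synthesisCoeff, synthesisCoeff, ← integral_const_mul, ← integral_add_right_eq_self _ y]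
    refine integral_congr_ae (.of_forall fun t => ?_)
    have hc : character w (t + y) = character w y * character w t := by
      rw [character, character, character, ← Complex.exp_add, inner_add_right]
      congr 1
      push_cast
      ring
    simp only [translate_apply, modulate_apply, add_sub_cancel_right, hc]
    rw [show t + y - x = t - (x - y) by abel]
    ring
  rw [h, norm_mul, norm_character, one_mul]

theorem norm_fourier_translate (x : Eucl d) (g : 𝓢(Eucl d, ℂ)) (ξ : Eucl d) :
    ‖(𝓕 (translate x g)) ξ‖ = ‖(𝓕 g) ξ‖ := by
  have h : (𝓕 (translate x g)) ξ = character (-x) ξ * (𝓕 g) ξ := by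
    rw [SchwartzMap.fourier_coe, SchwartzMap.fourier_coe, Real.fourier_eq', Real.fourier_eq',
      ← integral_const_mul, ← integral_add_right_eq_self _ x]
    refine integral_congr_ae (.of_forall fun t => ?_)
    simp only [translate_apply, add_sub_cancel_right, smul_eq_mul, character, ← mul_assoc,
      ← Complex.exp_add]
    congr 2
    rw [inner_add_left, inner_neg_left]
    push_cast
    ring
  rw [h, norm_mul, norm_character, one_mul]

theorem synthesisCoeff_eq_integral_fourier (g φ : 𝓢(Eucl d, ℂ)) (x w : Eucl d) :
    synthesisCoeff g φ x w = ∫ ξ, (𝓕⁻ φ) ξ * (translate w (𝓕 (translate x g))) ξ := by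
  have h := SchwartzMap.integral_fourier_mul_eq (𝓕⁻ φ) (modulate w (translate x g))
  rw [fourier_modulate] at h
  rw [← h, synthesisCoeff]
  simp

/-- The coefficients decay in `x` directly and in `w` by Parseval; the geometric mean of the two
bounds gives joint decay. -/
theorem exists_norm_synthesisCoeff_le (g : 𝓢(Eucl d, ℂ)) (M : ℕ) :
    ∃ q : Seminorm ℂ 𝓢(Eucl d, ℂ), Continuous q ∧ ∀ (φ : 𝓢(Eucl d, ℂ)) (x w : Eucl d),
      ‖synthesisCoeff g φ x w‖ * ((1 + ‖x‖) * (1 + ‖w‖)) ^ M ≤ q φ := by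
  set A : ℝ := ∫ t : Eucl d, ((1 + ‖t‖) ^ (d + 1))⁻¹ with hA
  have hA0 : 0 ≤ A := integral_nonneg fun t => by positivity
  set K := 2 * M with hK
  set a : ℝ≥0 := ⟨A * decaySeminorm K g, mul_nonneg hA0 (apply_nonneg _ _)⟩
  set b : ℝ≥0 := ⟨A * decaySeminorm K (𝓕 g), mul_nonneg hA0 (apply_nonneg _ _)⟩
  refine ⟨a • decaySeminorm (K + (d + 1)) + b • (decaySeminorm (K + (d + 1))).comp
    (fourierInvCLM ℂ 𝓢(Eucl d, ℂ)).toLinearMap, ?_, fun φ x w => ?_⟩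
  · exact ((continuous_decaySeminorm _).const_smul a).add
      (((continuous_decaySeminorm _).comp (fourierInvCLM ℂ 𝓢(Eucl d, ℂ)).continuous).const_smul b)
  set s := ‖synthesisCoeff g φ x w‖ with hs
  set u := decaySeminorm (K + (d + 1)) φ with hu
  set v := decaySeminorm (K + (d + 1)) (𝓕⁻ φ) with hv
  have h1 : s * (1 + ‖x‖) ^ K ≤ a * u := by
    have := norm_integral_mul_mul_pow_le K φ g (modulate w (translate x g)) x fun t => by
      rw [modulate_apply, norm_mul, norm_character, one_mul, translate_apply]
    refine this.trans_eq ?_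
    change A * u * decaySeminorm K g = A * decaySeminorm K g * u
    ring
  have h2 : s * (1 + ‖w‖) ^ K ≤ b * v := by
    rw [hs, synthesisCoeff_eq_integral_fourier]
    have := norm_integral_mul_mul_pow_le K (𝓕⁻ φ) (𝓕 g) (translate w (𝓕 (translate x g))) w
      fun t => by rw [translate_apply, norm_fourier_translate]
    refine this.trans_eq ?_
    change A * v * decaySeminorm K (𝓕 g) = A * decaySeminorm K (𝓕 g) * v
    ring
  have hu0 : 0 ≤ a * u := mul_nonneg a.2 (apply_nonneg _ _)
  have hv0 : 0 ≤ b * v := mul_nonneg b.2 (apply_nonneg _ _)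
  change s * ((1 + ‖x‖) * (1 + ‖w‖)) ^ M ≤ a * u + b * v
  refine abs_le_of_sq_le_sq' ?_ (by positivity) |>.2
  calc (s * ((1 + ‖x‖) * (1 + ‖w‖)) ^ M) ^ 2
      = (s * (1 + ‖x‖) ^ K) * (s * (1 + ‖w‖) ^ K) := by
        rw [hK]
        generalize 1 + ‖x‖ = X
        generalize 1 + ‖w‖ = W
        ring
    _ ≤ (a * u) * (b * v) := by gcongr
    _ ≤ (a * u + b * v) ^ 2 := by nlinarith [mul_nonneg hu0 hv0]

theorem slowlyGrowing_conjugate_modulate_translate (g : 𝓢(Eucl d, ℂ)) :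
    SlowlyGrowing (fun z : Eucl d × Eucl d => (1 + ‖z.1‖) * (1 + ‖z.2‖))
      fun z => conjugate (modulate z.2 (translate z.1 g)) := by
  have hν : ∀ z : Eucl d × Eucl d, 1 ≤ (1 + ‖z.1‖) * (1 + ‖z.2‖) := fun z => by
    nlinarith [norm_nonneg z.1, norm_nonneg z.2, mul_nonneg (norm_nonneg z.1) (norm_nonneg z.2)]
  have h := (((SlowlyGrowing.const g).translate hν (fun z => z.1) fun z => by
    nlinarith [norm_nonneg z.1, norm_nonneg z.2, mul_nonneg (norm_nonneg z.1)
      (norm_nonneg z.2)]).modulate hν (fun z => z.2) fun z => by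
    nlinarith [norm_nonneg z.1, norm_nonneg z.2, mul_nonneg (norm_nonneg z.1) (norm_nonneg z.2)])
  exact h.clm hν (SchwartzMap.postcompCLM (𝕜 := ℝ) (Complex.conjCLE : ℂ →L[ℝ] ℂ))

theorem conj_character (w t : Eucl d) : (starRingEnd ℂ) (character w t) =
    Complex.exp ((-2 * Real.pi * inner ℝ w t : ℝ) * Complex.I) := by
  rw [character, ← Complex.exp_conj, map_mul, Complex.conj_ofReal, Complex.conj_I]
  congr 1
  push_cast
  ring

/-- Fourier inversion in the modulation variable. -/
theorem integral_synthesisCoeff_mul (g φ : 𝓢(Eucl d, ℂ)) (x t : Eucl d) :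
    ∫ w, synthesisCoeff g φ x w * conjugate (modulate w (translate x g)) t =
      φ t * (‖g (t - x)‖ ^ 2 : ℝ) := by
  set ψ : 𝓢(Eucl d, ℂ) := pairing (ContinuousLinearMap.mul ℂ ℂ) φ (translate x g) with hψ
  have hψa : ∀ v, ψ v = φ v * g (v - x) := fun v => by
    rw [hψ, pairing_apply_apply]
    rfl
  have h1 : ∀ w, synthesisCoeff g φ x w = (𝓕⁻ ψ) w := by
    intro w
    rw [SchwartzMap.fourierInv_coe, Real.fourierInv_eq', synthesisCoeff]
    refine integral_congr_ae (.of_forall fun v => ?_)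
    simp only [hψa, modulate_apply, translate_apply, smul_eq_mul, character, real_inner_comm w v]
    ring
  have h2 : ψ t = ∫ w, (starRingEnd ℂ) (character w t) * (𝓕⁻ ψ) w := by
    have : (𝓕 (𝓕⁻ ψ)) t = ψ t := by simp
    rw [← this, SchwartzMap.fourier_coe, Real.fourier_eq']
    refine integral_congr_ae (.of_forall fun w => ?_)
    simp only [conj_character, smul_eq_mul]
  calc _ = ∫ w, (starRingEnd ℂ) (g (t - x)) * ((starRingEnd ℂ) (character w t) * (𝓕⁻ ψ) w) := by
        refine integral_congr_ae (.of_forall fun w => ?_)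
        simp only [h1, conjugate_apply, modulate_apply, translate_apply, map_mul]
        ring
    _ = _ := by
        rw [integral_const_mul, ← h2, hψa, Complex.ofReal_pow, ← Complex.conj_mul']
        ring

/-- The inversion formula for the short-time Fourier transform of a tempered distribution. -/
theorem integral_synthesisCoeff_mul_stft (g : 𝓢(Eucl d, ℂ)) (f : 𝓢'(Eucl d, ℂ))
    (φ : 𝓢(Eucl d, ℂ)) :
    ∫ z : Eucl d × Eucl d, synthesisCoeff g φ z.1 z.2 * stft g f z.1 z.2 =
      ((∫ t, ‖g t‖ ^ 2 : ℝ) : ℂ) * f φ := by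
  set Ψ : Eucl d × Eucl d → 𝓢(Eucl d, ℂ) := fun z =>
    synthesisCoeff g φ z.1 z.2 • conjugate (modulate z.2 (translate z.1 g)) with hΨ
  have hΨc : Continuous Ψ := by
    have h : Continuous fun z : Eucl d × Eucl d => conjugate (modulate z.2 (translate z.1 g)) :=
      continuous_conjugate.comp (continuous_modulate_translate g)
    exact (continuous_synthesisCoeff g φ).smul h
  have hint : ∀ k l, Integrable fun z => SchwartzMap.seminorm ℝ k l (Ψ z) := by
    intro k l
    obtain ⟨C, N, hC, hN⟩ := slowlyGrowing_conjugate_modulate_translate g k l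
    obtain ⟨q, -, hq⟩ := exists_norm_synthesisCoeff_le g (N + (d + 1))
    have hb : Integrable (fun z : Eucl d × Eucl d =>
        (((1 + ‖z.1‖) ^ (d + 1))⁻¹ * ((1 + ‖z.2‖) ^ (d + 1))⁻¹) * (q φ * C)) :=
      (integrable_one_add_norm_pow_inv.mul_prod integrable_one_add_norm_pow_inv).mul_const _
    refine hb.mono' (((schwartz_withSeminorms ℝ (Eucl d) ℂ).continuous_seminorm
      (k, l)).comp hΨc).aestronglyMeasurable (.of_forall fun z => ?_)
    rw [Real.norm_of_nonneg (apply_nonneg _ _)]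
    have e : SchwartzMap.seminorm ℝ k l (Ψ z) = ‖synthesisCoeff g φ z.1 z.2‖ *
        SchwartzMap.seminorm ℝ k l (conjugate (modulate z.2 (translate z.1 g))) :=
      map_smul_eq_mul (SchwartzMap.seminorm ℂ k l) _ _
    rw [e, ← mul_inv, ← mul_pow, inv_mul_eq_div, le_div_iff₀ (by positivity)]
    calc _ ≤ ‖synthesisCoeff g φ z.1 z.2‖ * (C * ((1 + ‖z.1‖) * (1 + ‖z.2‖)) ^ N) *
          ((1 + ‖z.1‖) * (1 + ‖z.2‖)) ^ (d + 1) := by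
          gcongr
          exact hN z
      _ = ‖synthesisCoeff g φ z.1 z.2‖ * ((1 + ‖z.1‖) * (1 + ‖z.2‖)) ^ (N + (d + 1)) * C := by
          rw [pow_add]
          ring
      _ ≤ _ := by
          gcongr
          exact hq φ z.1 z.2
  have hpt : ∀ t, (((∫ t, ‖g t‖ ^ 2 : ℝ) : ℂ) • φ) t = ∫ z, Ψ z t := by
    intro t
    have hI : Integrable (fun z => Ψ z t) (volume.prod volume) :=
      (hint 0 0).mono' (((TemperedDistribution.delta t).continuous.comp hΨc).aestronglyMeasurable)
        (.of_forall fun z => SchwartzMap.norm_le_seminorm ℝ (Ψ z) t)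
    rw [Measure.volume_eq_prod, integral_prod _ hI]
    have : ∀ x, ∫ w, Ψ (x, w) t = φ t * (‖g (t - x)‖ ^ 2 : ℝ) := fun x =>
      integral_synthesisCoeff_mul g φ x t
    simp_rw [this]
    rw [integral_const_mul, integral_complex_ofReal, integral_sub_left_eq_self (fun s => ‖g s‖ ^ 2)]
    change _ * φ t = _
    ring
  have := apply_eq_integral (μ := volume) (f : 𝓢(Eucl d, ℂ) →L[ℂ] ℂ) hΨc hint hpt
  have hsmul : ∀ (c : ℂ) (ψ : 𝓢(Eucl d, ℂ)), f (c • ψ) = c * f ψ := fun c ψ =>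
    map_smul (f : 𝓢(Eucl d, ℂ) →L[ℂ] ℂ) c ψ
  refine Eq.trans ?_ (this.symm.trans (hsmul _ φ))
  refine integral_congr_ae (.of_forall fun z => ?_)
  exact (hsmul _ _).symm

theorem integral_norm_sq_pos {g : 𝓢(Eucl d, ℂ)} (hg : g ≠ 0) : 0 < ∫ t, ‖g t‖ ^ 2 := by
  have hi : Integrable fun t => ‖g t‖ ^ 2 := (g.memLp 2).integrable_norm_pow (by norm_num)
  obtain ⟨t, ht⟩ : ∃ t, g t ≠ 0 := by
    by_contra! h
    exact hg (SchwartzMap.ext h)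
  rw [integral_pos_iff_support_of_nonneg (fun t => by positivity) hi]
  refine IsOpen.measure_pos _ ((g.continuous.norm.pow 2).isOpen_support) ⟨t, ?_⟩
  simpa using ht

/-- A tempered distribution is controlled by its short-time Fourier transform. -/
theorem enorm_apply_le_lintegral_stft {g : 𝓢(Eucl d, ℂ)} (hg : g ≠ 0) (f : 𝓢'(Eucl d, ℂ))
    (φ : 𝓢(Eucl d, ℂ)) :
    ‖f φ‖ₑ ≤ ENNReal.ofReal (∫ t, ‖g t‖ ^ 2)⁻¹ *
      ∫⁻ z : Eucl d × Eucl d, ‖synthesisCoeff g φ z.1 z.2‖ₑ * ‖stft g f z.1 z.2‖ₑ := by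
  have hc := integral_norm_sq_pos hg
  have h := integral_synthesisCoeff_mul_stft g f φ
  have h2 : f φ = (((∫ t, ‖g t‖ ^ 2)⁻¹ : ℝ) : ℂ) *
      ∫ z : Eucl d × Eucl d, synthesisCoeff g φ z.1 z.2 * stft g f z.1 z.2 := by
    rw [h, ← mul_assoc, ← Complex.ofReal_mul, inv_mul_cancel₀ hc.ne', Complex.ofReal_one, one_mul]
  rw [h2, enorm_mul]
  gcongr
  · rw [← ofReal_norm, Complex.norm_real, Real.norm_of_nonneg (inv_nonneg.2 hc.le)]
  · refine (enorm_integral_le_lintegral_enorm _).trans_eq ?_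
    simp_rw [enorm_mul]

end Modulation

namespace Modulation

variable {d : ℕ}

/-! ### Existence of the fractional integral of a tempered distribution -/

theorem continuous_apply_translate (f : 𝓢'(Eucl d, ℂ)) (φ : 𝓢(Eucl d, ℂ)) :
    Continuous fun y => f (translate y φ) := by
  have h1 : Continuous fun y : Eucl d => (y, φ) := continuous_id.prodMk continuous_const
  have h2 : Continuous fun y : Eucl d => translate y φ := continuous_translate.comp h1
  exact f.continuous.comp h2

theorem measurable_div_norm_rpow (γ : ℝ) {F : Eucl d → ℂ} (hF : Measurable F) (x : Eucl d) :
    Measurable fun y => F y / ((‖x - y‖ ^ γ : ℝ) : ℂ) := by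
  fun_prop

theorem integrable_div_norm_rpow_iff (γ : ℝ) {F : Eucl d → ℂ} (hF : Measurable F) (x : Eucl d) :
    Integrable (fun y => F y / ((‖x - y‖ ^ γ : ℝ) : ℂ)) ↔
      ∫⁻ y, ‖F y‖ₑ * rieszKernel γ (x - y) < ∞ := by
  simp_rw [← enorm_div_norm_rpow]
  exact ⟨fun h => h.2, fun h => ⟨(measurable_div_norm_rpow γ hF x).aestronglyMeasurable, h⟩⟩

theorem reflect_reflect (φ : 𝓢(Eucl d, ℂ)) : reflect (reflect φ) = φ := by
  ext t
  simp [reflect_apply]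

/-- If the pairing of `|·|^(-γ)` with the orbit `y ↦ f (φ (· - y))` is bounded by a continuous
seminorm of `φ`, then `|·|^(-γ) * f` exists, and it is given by that pairing. -/
theorem exists_isFracInt_of_lintegral_le (γ : ℝ) (f : 𝓢'(Eucl d, ℂ)) (q : Seminorm ℂ 𝓢(Eucl d, ℂ))
    (hq : Continuous q)
    (hf : ∀ φ, ∫⁻ y, ‖f (translate y φ)‖ₑ * rieszKernel γ y ≤ ENNReal.ofReal (q φ)) :
    ∃ h : 𝓢'(Eucl d, ℂ), IsFracInt γ f h ∧
      ∀ φ, h φ = ∫ y, f (translate y φ) / ((‖y‖ ^ γ : ℝ) : ℂ) := by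
  have hm : ∀ φ, Measurable fun y => f (translate y φ) := fun φ =>
    (continuous_apply_translate f φ).measurable
  have hI : ∀ φ, Integrable fun y => f (translate y φ) / ((‖y‖ ^ γ : ℝ) : ℂ) := by
    intro φ
    have := (integrable_div_norm_rpow_iff γ (hm φ) 0).2
    simp only [zero_sub, norm_neg, rieszKernel] at this
    exact this ((hf φ).trans_lt ENNReal.ofReal_lt_top)
  have hadd : ∀ φ ψ y, f (translate y (φ + ψ)) = f (translate y φ) + f (translate y ψ) :=
    fun φ ψ y => map_add (f : 𝓢(Eucl d, ℂ) →L[ℂ] ℂ) (translate y φ) (translate y ψ)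
  have hsmul : ∀ (c : ℂ) φ y, f (translate y (c • φ)) = c * f (translate y φ) :=
    fun c φ y => map_smul (f : 𝓢(Eucl d, ℂ) →L[ℂ] ℂ) c (translate y φ)
  obtain ⟨s, C, -, hC⟩ := Seminorm.bound_of_continuous (schwartz_withSeminorms ℂ (Eucl d) ℂ) q hq
  let H : 𝓢(Eucl d, ℂ) →L[ℂ] ℂ := SchwartzMap.mkCLMtoNormedSpace (𝕜 := ℂ) (σ := RingHom.id ℂ)
    (fun φ => ∫ y, f (translate y φ) / ((‖y‖ ^ γ : ℝ) : ℂ))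
    (fun φ ψ => by
      simp only [hadd, add_div]
      exact integral_add (hI φ) (hI ψ))
    (fun c φ => by
      simp only [hsmul, mul_div_assoc, RingHom.id_apply, smul_eq_mul]
      exact integral_const_mul _ _)
    ⟨s, C, C.2, fun φ => by
      refine le_trans ?_ (hC φ)
      rw [← ENNReal.ofReal_le_ofReal_iff (apply_nonneg _ _), ofReal_norm]
      refine (enorm_integral_le_lintegral_enorm _).trans ?_
      simp_rw [enorm_div_norm_rpow]
      exact hf φ⟩
  let h : 𝓢'(Eucl d, ℂ) :=
    ContinuousLinearMap.toPointwiseConvergenceCLM ℂ (RingHom.id ℂ) 𝓢(Eucl d, ℂ) ℂ H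
  have hh : ∀ φ, h φ = ∫ y, f (translate y φ) / ((‖y‖ ^ γ : ℝ) : ℂ) := fun φ => rfl
  refine ⟨h, fun φ x => ?_, hh⟩
  -- everything is translated to the case `x = 0`
  have e : ∀ y, f (translate (y - x) (translate x (reflect φ))) / ((‖y - x‖ ^ γ : ℝ) : ℂ) =
      conv f φ y / ((‖x - y‖ ^ γ : ℝ) : ℂ) := by
    intro y
    rw [translate_translate, sub_add_cancel, norm_sub_rev, conv]
  constructor
  · have := (hI (translate x (reflect φ))).comp_sub_right x
    simpa only [e] using this
  · rw [conv, hh, ← integral_sub_right_eq_self _ x, fracInt]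
    simp only [e]

theorem mem_domain_fracIntOp_of_isFracInt {γ : ℝ} {f h : 𝓢'(Eucl d, ℂ)} (H : IsFracInt γ f h) :
    ∃ hf : f ∈ (fracIntOp d γ).domain, fracIntOp d γ ⟨f, hf⟩ = h :=
  ⟨⟨h, H⟩, (fracIntOp_spec γ ⟨f, ⟨h, H⟩⟩).unique H⟩

/-! ### Schwartz functions -/

theorem exists_lintegral_mul_rieszKernel_le_seminorm {γ : ℝ} (hγ₀ : 0 < γ) (hγd : γ < d) :
    ∃ q : Seminorm ℂ 𝓢(Eucl d, ℂ), Continuous q ∧ ∀ (u : 𝓢(Eucl d, ℂ)) (x : Eucl d),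
      ∫⁻ y, ‖u y‖ₑ * rieszKernel γ (x - y) ≤ ENNReal.ofReal (q u) := by
  -- inside the unit ball around `x` the kernel is integrable, outside it is at most `1`
  obtain ⟨C, hC⟩ := exists_setLIntegral_ball_mul_rieszKernel_le (d := d) hγ₀ hγd
  set A : ℝ := ∫ t : Eucl d, ((1 + ‖t‖) ^ (d + 1))⁻¹ with hA
  have hA0 : 0 ≤ A := integral_nonneg fun t => by positivity
  set a : ℝ≥0 := ⟨A, hA0⟩ with ha
  refine ⟨C • decaySeminorm 0 + a • decaySeminorm (d + 1),
    ((continuous_decaySeminorm 0).const_smul C).add ((continuous_decaySeminorm _).const_smul a),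
    fun u x => ?_⟩
  have hum : Measurable fun y => ‖u y‖ₑ := u.continuous.measurable.enorm
  have e : (C • decaySeminorm 0 + a • decaySeminorm (d + 1) : Seminorm ℂ 𝓢(Eucl d, ℂ)) u =
      C * decaySeminorm 0 u + A * decaySeminorm (d + 1) u := rfl
  rw [e, ENNReal.ofReal_add (mul_nonneg C.coe_nonneg (apply_nonneg (decaySeminorm 0) u))
    (mul_nonneg hA0 (apply_nonneg (decaySeminorm (d + 1)) u)),
    ← lintegral_add_compl _ (measurableSet_ball (x := x) (ε := 1))]
  refine add_le_add ?_ ?_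
  · refine (hC _ hum x 1 (ENNReal.ofReal (decaySeminorm 0 u)) one_pos fun r hr => ?_).trans_eq ?_
    · calc _ ≤ ∫⁻ y in Metric.ball x r, ENNReal.ofReal (decaySeminorm 0 u) := by
            refine lintegral_mono fun y => ?_
            rw [← ofReal_norm]
            have := one_add_norm_pow_mul_norm_le 0 u y
            rw [pow_zero, one_mul] at this
            gcongr
        _ = _ := by simp [mul_comm]
    · rw [ENNReal.ofReal_mul C.coe_nonneg]
      simp
  · calc _ ≤ ∫⁻ y in (Metric.ball x 1)ᶜ, ‖u y‖ₑ := by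
          refine setLIntegral_mono' measurableSet_ball.compl fun y hy => ?_
          have hy' : 1 ≤ ‖x - y‖ := by
            rwa [Set.mem_compl_iff, Metric.mem_ball, dist_comm, dist_eq_norm, not_lt] at hy
          have := rieszKernel_le hγ₀.le one_pos hy'
          simp only [Real.one_rpow, inv_one, ENNReal.ofReal_one] at this
          exact mul_le_of_le_one_right' this
      _ ≤ ∫⁻ y, ‖u y‖ₑ := setLIntegral_le_lintegral _ _
      _ ≤ ∫⁻ y : Eucl d, ENNReal.ofReal (((1 + ‖y‖) ^ (d + 1))⁻¹ * decaySeminorm (d + 1) u) := by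
          refine lintegral_mono fun y => ?_
          rw [← ofReal_norm]
          gcongr
          rw [inv_mul_eq_div, le_div_iff₀ (by positivity), mul_comm]
          exact one_add_norm_pow_mul_norm_le (d + 1) u y
      _ = _ := by
          rw [← ofReal_integral_eq_lintegral_ofReal
            (integrable_one_add_norm_pow_inv.mul_const _)
            (.of_forall fun y => mul_nonneg (by positivity) (apply_nonneg _ _)),
            integral_mul_const]

theorem integrable_schwartz_div_norm_rpow {γ : ℝ} (hγ₀ : 0 < γ) (hγd : γ < d)
    (u : 𝓢(Eucl d, ℂ)) (x : Eucl d) :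
    Integrable fun y => u y / ((‖x - y‖ ^ γ : ℝ) : ℂ) := by
  obtain ⟨q, -, hq⟩ := exists_lintegral_mul_rieszKernel_le_seminorm (d := d) hγ₀ hγd
  exact (integrable_div_norm_rpow_iff γ u.continuous.measurable x).2
    ((hq u x).trans_lt ENNReal.ofReal_lt_top)

theorem toTemperedDistribution_translate (u φ : 𝓢(Eucl d, ℂ)) (y : Eucl d) :
    toTemperedDistributionCLM (Eucl d) ℂ volume u (translate y φ) = ∫ t, φ t * u (t + y) := by
  refine (toTemperedDistributionCLM_apply_apply volume u _).trans ?_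
  rw [← integral_add_right_eq_self _ y]
  simp only [translate_apply, add_sub_cancel_right, smul_eq_mul]

/-- For Schwartz functions `φ` and `u`, the kernel `φ(t) u(t + y) |y|^(-γ)` is integrable in both
variables. -/
theorem integrable_prod_mul_div_norm_rpow {γ : ℝ} (hγ₀ : 0 < γ) (hγd : γ < d)
    (u φ : 𝓢(Eucl d, ℂ)) :
    Integrable (fun z : Eucl d × Eucl d => φ z.1 * (u (z.1 + z.2) / ((‖z.2‖ ^ γ : ℝ) : ℂ)))
      (volume.prod volume) := by
  obtain ⟨q, -, hq⟩ := exists_lintegral_mul_rieszKernel_le_seminorm (d := d) hγ₀ hγd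
  have hφ := φ.continuous.measurable
  have hu := u.continuous.measurable
  have hm : Measurable fun z : Eucl d × Eucl d =>
      φ z.1 * (u (z.1 + z.2) / ((‖z.2‖ ^ γ : ℝ) : ℂ)) := by
    fun_prop
  refine ⟨hm.aestronglyMeasurable, ?_⟩
  rw [hasFiniteIntegral_iff_enorm, lintegral_prod _ hm.enorm.aemeasurable]
  calc _ ≤ ∫⁻ t, ‖φ t‖ₑ * ENNReal.ofReal (q u) := by
        refine lintegral_mono fun t => ?_
        simp_rw [enorm_mul, enorm_div_norm_rpow]
        rw [lintegral_const_mul _ (by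
          have := measurable_rieszKernel (d := d) γ
          fun_prop)]
        gcongr
        rw [← lintegral_sub_right_eq_self _ t]
        refine le_trans (le_of_eq ?_) (hq u t)
        refine lintegral_congr fun y => ?_
        rw [add_sub_cancel, rieszKernel, rieszKernel, norm_sub_rev]
    _ < ∞ := by
        rw [lintegral_mul_const _ hφ.enorm]
        exact ENNReal.mul_lt_top φ.integrable.2 ENNReal.ofReal_lt_top

theorem fracInt_eq_integral_add (γ : ℝ) (u : Eucl d → ℂ) (x : Eucl d) :
    fracInt γ u x = ∫ y, u (x + y) / ((‖y‖ ^ γ : ℝ) : ℂ) := by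
  rw [fracInt, ← integral_add_left_eq_self _ x]
  simp

theorem exists_isFracInt_schwartz {γ : ℝ} (hγ₀ : 0 < γ) (hγd : γ < d) (u : 𝓢(Eucl d, ℂ)) :
    ∃ h : 𝓢'(Eucl d, ℂ), IsFracInt γ (toTemperedDistributionCLM (Eucl d) ℂ volume u) h ∧
      ∀ φ, Integrable (fun x => φ x * fracInt γ u x) ∧ h φ = ∫ x, φ x * fracInt γ u x := by
  obtain ⟨q, hqc, hq⟩ := exists_lintegral_mul_rieszKernel_le_seminorm (d := d) hγ₀ hγd
  set A : ℝ≥0 := (∫⁻ t, ‖u t‖ₑ).toNNReal with hA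
  have hAe : (A : ℝ≥0∞) = ∫⁻ t, ‖u t‖ₑ := ENNReal.coe_toNNReal u.integrable.2.ne
  have hbound : ∀ φ : 𝓢(Eucl d, ℂ),
      ∫⁻ y, ‖toTemperedDistributionCLM (Eucl d) ℂ volume u (translate y φ)‖ₑ * rieszKernel γ y ≤
        ENNReal.ofReal ((A • q) φ) := by
    intro φ
    have hφm := φ.continuous.measurable
    have hum := u.continuous.measurable
    have hK := measurable_rieszKernel (d := d) γ
    calc _ ≤ ∫⁻ y, (∫⁻ t, ‖φ (t - y)‖ₑ * ‖u t‖ₑ) * rieszKernel γ y := by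
          refine lintegral_mono fun y => ?_
          gcongr
          have e : toTemperedDistributionCLM (Eucl d) ℂ volume u (translate y φ) =
              ∫ t, φ (t - y) * u t :=
            toTemperedDistributionCLM_apply_apply volume u (translate y φ)
          rw [e]
          refine (enorm_integral_le_lintegral_enorm _).trans_eq ?_
          simp_rw [enorm_mul]
      _ = ∫⁻ y, ∫⁻ t, ‖φ (t - y)‖ₑ * ‖u t‖ₑ * rieszKernel γ y := by
          refine lintegral_congr fun y => ?_
          rw [lintegral_mul_const _ (by fun_prop)]
      _ = ∫⁻ t, ∫⁻ y, ‖φ (t - y)‖ₑ * ‖u t‖ₑ * rieszKernel γ y := by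
          refine lintegral_lintegral_swap (Measurable.aemeasurable ?_)
          simp only [Function.uncurry_def]
          fun_prop
      _ = ∫⁻ t, (∫⁻ y, ‖φ y‖ₑ * rieszKernel γ (t - y)) * ‖u t‖ₑ := by
          refine lintegral_congr fun t => ?_
          rw [← lintegral_sub_left_eq_self _ t, ← lintegral_mul_const _ (by fun_prop)]
          refine lintegral_congr fun y => ?_
          rw [sub_sub_cancel]
          ring
      _ ≤ ∫⁻ t, ENNReal.ofReal (q φ) * ‖u t‖ₑ := by
          gcongr with t
          exact hq φ t
      _ = _ := by
          rw [lintegral_const_mul _ (by fun_prop), ← hAe]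
          change _ = ENNReal.ofReal (A * q φ)
          rw [ENNReal.ofReal_mul A.coe_nonneg, ENNReal.ofReal_coe_nnreal, mul_comm]
  obtain ⟨h, hh, hint⟩ := exists_isFracInt_of_lintegral_le γ
    (toTemperedDistributionCLM (Eucl d) ℂ volume u) (A • q) (hqc.const_smul A) hbound
  refine ⟨h, hh, fun φ => ?_⟩
  have hI := integrable_prod_mul_div_norm_rpow hγ₀ hγd u φ
  constructor
  · refine hI.integral_prod_left.congr (.of_forall fun t => ?_)
    simp only [integral_const_mul, ← fracInt_eq_integral_add]
  · rw [hint]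
    have hswap := integral_integral_swap
      (f := fun t y => φ t * (u (t + y) / ((‖y‖ ^ γ : ℝ) : ℂ))) hI
    simp only [integral_const_mul, ← fracInt_eq_integral_add] at hswap
    rw [hswap]
    refine integral_congr_ae (.of_forall fun y => ?_)
    simp only [toTemperedDistribution_translate, ← integral_div, mul_div_assoc]

end Modulation

namespace Modulation

variable {d : ℕ}

/-! ### Existence of the fractional integral on modulation spaces -/

/-- The integrable weight `(1 + |x|)^(-(d+1))`. -/
noncomputable def decayWeight (x : Eucl d) : ℝ≥0∞ := ENNReal.ofReal (((1 + ‖x‖) ^ (d + 1))⁻¹)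

theorem measurable_decayWeight : Measurable (decayWeight : Eucl d → ℝ≥0∞) := by
  unfold decayWeight
  fun_prop

theorem lintegral_decayWeight_lt_top : ∫⁻ x : Eucl d, decayWeight x < ∞ := by
  have h := (integrable_one_add_norm_pow_inv (d := d)).2
  rw [hasFiniteIntegral_iff_ofReal (.of_forall fun x => by positivity)] at h
  exact h

theorem decayWeight_le_one (x : Eucl d) : decayWeight x ≤ 1 := by
  rw [decayWeight, ENNReal.ofReal_le_one]
  exact inv_le_one_of_one_le₀ (one_le_pow₀ (by linarith [norm_nonneg x]))

/-- A function in `L^q` is integrable against the weight, whatever `q ≥ 1` is. -/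
theorem lintegral_decayWeight_mul_lt_top {q : ℝ≥0∞} (hq : 1 ≤ q) {G : Eucl d → ℝ≥0∞}
    (hG : Measurable G) (hGq : eLpNorm G q volume < ∞) : ∫⁻ w, decayWeight w * G w < ∞ := by
  -- the weighted measure is finite and below Lebesgue measure, so `L^q ⊆ L^1` applies to it
  set μ : Measure (Eucl d) := volume.withDensity decayWeight with hμ
  have hfin : IsFiniteMeasure μ := isFiniteMeasure_withDensity lintegral_decayWeight_lt_top.ne
  have hle : μ ≤ volume := by
    refine (withDensity_mono (.of_forall decayWeight_le_one)).trans_eq ?_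
    exact withDensity_one
  have h1 : MemLp G q μ :=
    ⟨hG.aestronglyMeasurable, (eLpNorm_mono_measure G hle).trans_lt hGq⟩
  have h2 := (h1.mono_exponent hq).2
  rw [eLpNorm_one_eq_lintegral_enorm, hμ,
    lintegral_withDensity_eq_lintegral_mul _ measurable_decayWeight (by fun_prop)] at h2
  simpa using h2

theorem eLpNorm_ofReal_eq {p : ℝ} (hp : 0 < p) (F : Eucl d → ℂ) :
    eLpNorm F (ENNReal.ofReal p) volume = (∫⁻ x, ‖F x‖ₑ ^ p) ^ (1 / p) := by
  rw [eLpNorm_eq_lintegral_rpow_enorm_toReal (by simpa using hp) ENNReal.ofReal_ne_top,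
    ENNReal.toReal_ofReal hp.le]

theorem measurable_eLpNorm_stft (g : 𝓢(Eucl d, ℂ)) (f : 𝓢'(Eucl d, ℂ)) {p : ℝ} (hp : 0 < p) :
    Measurable fun w => eLpNorm (fun x => stft g f x w) (ENNReal.ofReal p) volume := by
  simp_rw [eLpNorm_ofReal_eq hp]
  have h := (continuous_stft g f).measurable
  refine Measurable.pow_const ?_ _
  exact Measurable.lintegral_prod_left' (f := fun z : Eucl d × Eucl d => ‖stft g f z.1 z.2‖ₑ ^ p)
    (by fun_prop)

theorem lintegral_decayWeight_mul_eLpNorm_stft_lt_top (g : 𝓢(Eucl d, ℂ)) {f : 𝓢'(Eucl d, ℂ)}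
    {p : ℝ} (hp : 0 < p) {q : ℝ≥0∞} (hq : 1 ≤ q) {s : ℝ} (hs : 0 ≤ s)
    (hf : f ∈ modSpace g (ENNReal.ofReal p) q s) :
    ∫⁻ w, decayWeight w * eLpNorm (fun x => stft g f x w) (ENNReal.ofReal p) volume < ∞ := by
  have hN := measurable_eLpNorm_stft g f hp
  refine lt_of_le_of_lt (lintegral_mono fun w => ?_)
    (lintegral_decayWeight_mul_lt_top hq (by fun_prop) hf)
  refine mul_le_mul_right (le_mul_of_one_le_right' ?_) _
  rw [← ENNReal.ofReal_one]
  exact ENNReal.ofReal_le_ofReal (Real.one_le_rpow (by nlinarith [sq_nonneg ‖w‖]) (by positivity))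

/-- A tempered distribution is bounded by a seminorm, uniformly on small translates. -/
theorem exists_norm_apply_translate_le (f : 𝓢'(Eucl d, ℂ)) :
    ∃ q : Seminorm ℂ 𝓢(Eucl d, ℂ), Continuous q ∧
      ∀ φ y, ‖y‖ ≤ 1 → ‖f (translate y φ)‖ ≤ q φ := by
  have hcont := (schwartz_withSeminorms ℂ (Eucl d) ℂ).continuous_seminorm
  obtain ⟨s, C, -, hC⟩ := Seminorm.bound_of_continuous (schwartz_withSeminorms ℂ (Eucl d) ℂ)
    ((normSeminorm ℂ ℂ).comp (f : 𝓢(Eucl d, ℂ) →L[ℂ] ℂ).toLinearMap)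
    (continuous_norm.comp f.continuous)
  let Q : ℕ × ℕ → Seminorm ℂ 𝓢(Eucl d, ℂ) := fun i =>
    (4 ^ i.1 : ℝ≥0) • (SchwartzMap.seminorm ℂ i.1 i.2 + SchwartzMap.seminorm ℂ 0 i.2)
  have hQ : ∀ i, Continuous (Q i) := fun i =>
    ((hcont i).add (hcont (0, i.2))).const_smul (4 ^ i.1 : ℝ≥0)
  have hQe : ∀ i φ, Q i φ =
      4 ^ i.1 * (SchwartzMap.seminorm ℂ i.1 i.2 φ + SchwartzMap.seminorm ℂ 0 i.2 φ) := by
    intro i φ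
    change ((4 ^ i.1 : ℝ≥0) : ℝ) * _ = _
    push_cast
    rfl
  refine ⟨C • ∑ i ∈ s, Q i, ?_, fun φ y hy => (hC (translate y φ)).trans ?_⟩
  · refine Continuous.const_smul ?_ C
    exact Finset.sum_induction Q (fun q => Continuous q) (fun _ _ h h' => h.add h')
      continuous_const fun i _ => hQ i
  · refine mul_le_mul_of_nonneg_left ?_ C.2
    refine Seminorm.finset_sup_apply_le (apply_nonneg _ _) fun i hi => ?_
    have h1 : SchwartzMap.seminorm ℂ i.1 i.2 (translate y φ) ≤ Q i φ := by
      refine (seminorm_translate_le y φ i.1 i.2).trans ?_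
      rw [hQe, show (4 : ℝ) = 2 * 2 by norm_num, mul_pow]
      have : 1 + ‖y‖ ≤ 2 := by linarith
      have h0 := add_nonneg (apply_nonneg (SchwartzMap.seminorm ℂ i.1 i.2) φ)
        (apply_nonneg (SchwartzMap.seminorm ℂ 0 i.2) φ)
      exact mul_le_mul_of_nonneg_right (by gcongr) h0
    exact h1.trans ((Finset.single_le_sum (f := Q) (fun i _ φ => apply_nonneg (Q i) φ) hi) φ)

theorem exists_setLIntegral_unitBall_le {γ : ℝ} (hγ₀ : 0 < γ) (hγd : γ < d) :
    ∃ C : ℝ≥0, ∀ u : Eucl d → ℝ≥0∞, Measurable u → ∀ B : ℝ≥0∞, (∀ y, ‖y‖ ≤ 1 → u y ≤ B) →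
      ∫⁻ y in Metric.ball 0 1, u y * rieszKernel γ y ≤ C * B := by
  obtain ⟨C, hC⟩ := exists_setLIntegral_ball_mul_rieszKernel_le (d := d) hγ₀ hγd
  refine ⟨C, fun u hu B hB => ?_⟩
  have hind : ∀ y ∈ Metric.ball (0 : Eucl d) 1, u y ≤ B := fun y hy =>
    hB y (mem_ball_zero_iff.1 hy).le
  have h := hC _ (hu.indicator (measurableSet_ball (x := (0 : Eucl d)) (ε := 1))) 0 1 B one_pos
    fun r _ => ?_
  · rw [Real.one_rpow, ENNReal.ofReal_one, mul_one] at h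
    refine le_trans (le_of_eq (setLIntegral_congr_fun measurableSet_ball fun y hy => ?_)) h
    simp only [Set.indicator_of_mem hy, zero_sub, rieszKernel, norm_neg]
  · calc _ ≤ ∫⁻ y in Metric.ball (0 : Eucl d) r, B :=
          lintegral_mono fun y => Set.indicator_le' hind (fun _ _ => bot_le) y
      _ = _ := by rw [setLIntegral_const, mul_comm]

/-- Far from the singularity, the inversion formula for the short-time Fourier transform reduces
the bound to Hölder's inequality at each frequency. -/
theorem exists_setLIntegral_compl_unitBall_apply_translate_le {γ p a : ℝ} (hγ₀ : 0 < γ)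
    (hp : 1 < p) (ha : 0 < a) (hpa : d * (1 - 1 / p) - γ = -a) {g : 𝓢(Eucl d, ℂ)} (hg : g ≠ 0) :
    ∃ (C : ℝ≥0) (q : Seminorm ℂ 𝓢(Eucl d, ℂ)), Continuous q ∧
      ∀ (f : 𝓢'(Eucl d, ℂ)) (φ : 𝓢(Eucl d, ℂ)),
      ∫⁻ y in (Metric.ball 0 1)ᶜ, ‖f (translate y φ)‖ₑ * rieszKernel γ y ≤
        C * ENNReal.ofReal (q φ) *
          ∫⁻ w, decayWeight w * eLpNorm (fun x => stft g f x w) (ENNReal.ofReal p) volume := by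
  have hp0 : 0 < p := zero_lt_one.trans hp
  obtain ⟨C₂, hC₂⟩ := exists_setLIntegral_compl_ball_mul_rieszKernel_le (d := d) hγ₀ hp ha hpa
  obtain ⟨q, hqc, hq⟩ := exists_norm_synthesisCoeff_le g (d + 1)
  have hκm := measurable_decayWeight (d := d)
  have hKm := measurable_rieszKernel (d := d) γ
  set I : ℝ≥0 := (∫ t, ‖g t‖ ^ 2)⁻¹.toNNReal with hI
  set A : ℝ≥0 := (∫⁻ x : Eucl d, decayWeight x).toNNReal with hA
  have hAe : (A : ℝ≥0∞) = ∫⁻ x : Eucl d, decayWeight x :=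
    ENNReal.coe_toNNReal lintegral_decayWeight_lt_top.ne
  refine ⟨I * (C₂ * A), q, hqc, fun f φ => ?_⟩
  have hV := (continuous_stft g f).measurable
  have hsyn : ∀ x w, ‖synthesisCoeff g φ x w‖ₑ ≤
      ENNReal.ofReal (q φ) * (decayWeight x * decayWeight w) := by
    intro x w
    rw [decayWeight, decayWeight, ← ENNReal.ofReal_mul (by positivity), ← mul_inv, ← mul_pow,
      ← ENNReal.ofReal_mul (apply_nonneg _ _), ← ofReal_norm, ← div_eq_mul_inv]
    refine ENNReal.ofReal_le_ofReal ?_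
    rw [le_div_iff₀ (by positivity)]
    exact hq φ x w
  have hinv : (volume : Measure (Eucl d × Eucl d)).IsAddRightInvariant := by
    rw [Measure.volume_eq_prod]
    infer_instance
  have hpt : ∀ y, ‖f (translate y φ)‖ₑ ≤ I * (ENNReal.ofReal (q φ) *
      ∫⁻ z : Eucl d × Eucl d, decayWeight z.1 * decayWeight z.2 * ‖stft g f (z.1 + y) z.2‖ₑ) := by
    intro y
    refine (enorm_apply_le_lintegral_stft hg f (translate y φ)).trans ?_
    refine mul_le_mul_right ?_ _
    -- the translation by `y` is moved from the coefficient to the short-time Fourier transform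
    rw [← lintegral_add_right_eq_self _ (y, (0 : Eucl d)), ← lintegral_const_mul _ (by fun_prop)]
    refine lintegral_mono fun z => ?_
    have e : ‖synthesisCoeff g (translate y φ) (z.1 + y) z.2‖ₑ =
        ‖synthesisCoeff g φ z.1 z.2‖ₑ := by
      rw [← ofReal_norm, norm_synthesisCoeff_translate, add_sub_cancel_right, ofReal_norm]
    simp only [Prod.fst_add, Prod.snd_add, add_zero]
    rw [e, ← mul_assoc]
    exact mul_le_mul_left (hsyn _ _) _
  have hfar : ∀ x w, ∫⁻ y in (Metric.ball 0 1)ᶜ, ‖stft g f (x + y) w‖ₑ * rieszKernel γ y ≤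
      C₂ * eLpNorm (fun x => stft g f x w) (ENNReal.ofReal p) volume := by
    intro x w
    have h := hC₂ (fun y => ‖stft g f (x + y) w‖ₑ) (by fun_prop) 0 1 one_pos
    rw [Real.one_rpow, ENNReal.ofReal_one, mul_one,
      lintegral_add_left_eq_self (fun y => ‖stft g f y w‖ₑ ^ p) x] at h
    rw [eLpNorm_ofReal_eq hp0]
    simpa only [zero_sub, rieszKernel, norm_neg] using h
  calc _ ≤ ∫⁻ y in (Metric.ball 0 1)ᶜ, I * ENNReal.ofReal (q φ) * ∫⁻ z : Eucl d × Eucl d,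
          decayWeight z.1 * decayWeight z.2 * (‖stft g f (z.1 + y) z.2‖ₑ * rieszKernel γ y) := by
        refine lintegral_mono fun y => ?_
        simp only [← mul_assoc]
        rw [lintegral_mul_const _ (by fun_prop), ← mul_assoc]
        refine mul_le_mul_left ((hpt y).trans_eq ?_) _
        rw [mul_assoc]
    _ = I * ENNReal.ofReal (q φ) * ∫⁻ z : Eucl d × Eucl d, ∫⁻ y in (Metric.ball 0 1)ᶜ,
          decayWeight z.1 * decayWeight z.2 * (‖stft g f (z.1 + y) z.2‖ₑ * rieszKernel γ y) := by
        rw [lintegral_const_mul' _ _ (by finiteness), lintegral_lintegral_swap]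
        refine Measurable.aemeasurable ?_
        simp only [Function.uncurry_def]
        fun_prop
    _ ≤ I * ENNReal.ofReal (q φ) * ∫⁻ z : Eucl d × Eucl d, decayWeight z.1 * (C₂ *
          (decayWeight z.2 * eLpNorm (fun x => stft g f x z.2) (ENNReal.ofReal p) volume)) := by
        refine mul_le_mul_right (lintegral_mono fun z => ?_) _
        rw [lintegral_const_mul _ (by fun_prop)]
        refine (mul_le_mul_right (hfar z.1 z.2) _).trans_eq ?_
        ring
    _ = _ := by
        have hN := measurable_eLpNorm_stft g f hp0
        rw [Measure.volume_eq_prod, lintegral_prod_mul (f := decayWeight) (g := fun w => C₂ * (decayWeight w *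
          eLpNorm (fun x => stft g f x w) (ENNReal.ofReal p) volume))
          hκm.aemeasurable (by fun_prop), lintegral_const_mul _ (by fun_prop), ← hAe]
        push_cast
        ring

/-- The fractional integral is defined on the whole modulation space: the part of the pairing near
the singularity is bounded for every tempered distribution, the part far from it by the norm. The
exponent `a` is `d / p₂` in the setting of the Hardy–Littlewood–Sobolev inequality. -/
theorem exists_isFracInt_of_mem_modSpace {γ p a : ℝ} (hγ₀ : 0 < γ) (hγd : γ < d)
    (hp : 1 < p) (ha : 0 < a) (hpa : d * (1 - 1 / p) - γ = -a) {q : ℝ≥0∞} (hq : 1 ≤ q) {s : ℝ}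
    (hs : 0 ≤ s) {g : 𝓢(Eucl d, ℂ)} (hg : g ≠ 0) {f : 𝓢'(Eucl d, ℂ)}
    (hf : f ∈ modSpace g (ENNReal.ofReal p) q s) : ∃ h, IsFracInt γ f h := by
  obtain ⟨C, hC⟩ := exists_setLIntegral_unitBall_le (d := d) hγ₀ hγd
  obtain ⟨q₁, hq₁c, hq₁⟩ := exists_norm_apply_translate_le f
  obtain ⟨C', q₂, hq₂c, hq₂⟩ :=
    exists_setLIntegral_compl_unitBall_apply_translate_le (d := d) hγ₀ hp ha hpa hg
  set B : ℝ≥0 := (∫⁻ w, decayWeight w *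
    eLpNorm (fun x => stft g f x w) (ENNReal.ofReal p) volume).toNNReal with hB
  have hBe : (B : ℝ≥0∞) = ∫⁻ w, decayWeight w *
      eLpNorm (fun x => stft g f x w) (ENNReal.ofReal p) volume :=
    ENNReal.coe_toNNReal (lintegral_decayWeight_mul_eLpNorm_stft_lt_top g
      (zero_lt_one.trans hp) hq hs hf).ne
  refine (exists_isFracInt_of_lintegral_le γ f (C • q₁ + (C' * B) • q₂)
    ((hq₁c.const_smul C).add (hq₂c.const_smul (C' * B))) fun φ => ?_).imp
    fun _ => And.left
  have e : (C • q₁ + (C' * B) • q₂ : Seminorm ℂ 𝓢(Eucl d, ℂ)) φ =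
      C * q₁ φ + C' * B * q₂ φ := by
    change (C : ℝ) * q₁ φ + ((C' * B : ℝ≥0) : ℝ) * q₂ φ = _
    push_cast
    rfl
  have hm := (continuous_apply_translate f φ).measurable
  rw [e, ENNReal.ofReal_add (by positivity) (by positivity),
    ← lintegral_add_compl _ (measurableSet_ball (x := (0 : Eucl d)) (ε := 1))]
  refine add_le_add ?_ ?_
  · refine (hC _ hm.enorm (ENNReal.ofReal (q₁ φ)) fun y hy => ?_).trans_eq ?_
    · rw [← ofReal_norm]
      exact ENNReal.ofReal_le_ofReal (hq₁ φ y hy)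
    · rw [ENNReal.ofReal_mul C.coe_nonneg, ENNReal.ofReal_coe_nnreal]
  · refine (hq₂ f φ).trans_eq ?_
    rw [← hBe, ENNReal.ofReal_mul (by positivity), ENNReal.ofReal_mul (by positivity),
      ENNReal.ofReal_coe_nnreal, ENNReal.ofReal_coe_nnreal]
    ring

/-! ### Boundedness -/

/-- Up to a unimodular factor, the short-time Fourier transform at the frequency `w` is the
convolution with a Schwartz function that depends only on `w`. -/
theorem stft_eq_character_mul_conv (g : 𝓢(Eucl d, ℂ)) (f : 𝓢'(Eucl d, ℂ)) (x w : Eucl d) :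
    stft g f x w = (starRingEnd ℂ) (character w x) *
      conv f (reflect (conjugate (modulate w g))) x := by
  have e : conjugate (modulate w (translate x g)) = (starRingEnd ℂ) (character w x) •
      translate x (reflect (reflect (conjugate (modulate w g)))) := by
    ext t
    have hc : character w t = character w x * character w (t - x) := by
      rw [character, character, character, ← Complex.exp_add, inner_sub_right]
      congr 1
      push_cast
      ring
    rw [reflect_reflect, smul_apply, translate_apply, conjugate_apply,
      conjugate_apply, modulate_apply, modulate_apply, translate_apply, hc]
    simp only [map_mul, smul_eq_mul]
    ring
  rw [stft, e]
  exact map_smul (f : 𝓢(Eucl d, ℂ) →L[ℂ] ℂ) _ _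

theorem enorm_stft_eq (g : 𝓢(Eucl d, ℂ)) (f : 𝓢'(Eucl d, ℂ)) (x w : Eucl d) :
    ‖stft g f x w‖ₑ = ‖conv f (reflect (conjugate (modulate w g))) x‖ₑ := by
  rw [stft_eq_character_mul_conv, ← ofReal_norm, norm_mul, RCLike.norm_conj, norm_character,
    one_mul, ofReal_norm]

/-- At each frequency, the short-time Fourier transform of `|·|^(-γ) * f` is bounded by the
fractional integral of that of `f`. -/
theorem IsFracInt.enorm_stft_le {γ : ℝ} {f h : 𝓢'(Eucl d, ℂ)} (H : IsFracInt γ f h)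
    (g : 𝓢(Eucl d, ℂ)) (x w : Eucl d) :
    ‖stft g h x w‖ₑ ≤ ∫⁻ y, ‖stft g f y w‖ₑ * rieszKernel γ (x - y) := by
  simp_rw [enorm_stft_eq]
  rw [(H _ x).2]
  refine (enorm_integral_le_lintegral_enorm _).trans_eq ?_
  simp_rw [enorm_div_norm_rpow]

/-- The Hardy–Littlewood–Sobolev inequality is applied in `x` at each frequency `w`; the outer norm
in `w` is then only monotone. -/
theorem exists_modNorm_le_of_isFracInt {γ p₁ p₂ : ℝ} (hγ₀ : 0 < γ) (hγd : γ < d)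
    (hp₁ : 1 < p₁) (hp₁₂ : p₁ < p₂) (hp : 1 / p₁ + γ / d - 1 = 1 / p₂) :
    ∃ C : ℝ≥0, ∀ (g : 𝓢(Eucl d, ℂ)) (q : ℝ≥0∞) (s : ℝ) (f h : 𝓢'(Eucl d, ℂ)), IsFracInt γ f h →
      modNorm g (ENNReal.ofReal p₂) q s h ≤ C * modNorm g (ENNReal.ofReal p₁) q s f := by
  obtain ⟨C, hC⟩ := exists_lintegral_rieszPotential_rpow_le (d := d) hγ₀ hγd hp₁ hp₁₂ hp
  refine ⟨C, fun g q s f h H => ?_⟩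
  have hp₁0 : 0 < p₁ := zero_lt_one.trans hp₁
  have hp₂0 : 0 < p₂ := hp₁0.trans hp₁₂
  have hV := (continuous_stft g f).measurable
  have key : ∀ w, eLpNorm (fun x => stft g h x w) (ENNReal.ofReal p₂) volume ≤
      C * eLpNorm (fun x => stft g f x w) (ENNReal.ofReal p₁) volume := by
    intro w
    rw [eLpNorm_ofReal_eq hp₁0, eLpNorm_ofReal_eq hp₂0]
    refine le_trans ?_ (hC (fun y => ‖stft g f y w‖ₑ) (by fun_prop))
    gcongr with x
    exact H.enorm_stft_le g x w
  refine eLpNorm_le_mul_eLpNorm_of_ae_le_mul' (.of_forall fun w => ?_) q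
  simp only [enorm_eq_self]
  rw [← mul_assoc]
  exact mul_le_mul_left (key w) _

end Modulation

theorem mainTheorem9 (d : ℕ) (γ p₁ p₂ : ℝ) (hγ₀ : 0 < γ) (hγd : γ < d)
    (hp₁ : 1 < p₁) (hp₁₂ : p₁ < p₂) (hp : 1 / p₁ + γ / d - 1 = 1 / p₂)
    (q : ℝ≥0∞) (hq : 1 ≤ q) (s : ℝ) (hs : 0 ≤ s)
    (g : 𝓢(Modulation.Eucl d, ℂ)) (hg : g ≠ 0) :
    -- on Schwartz functions the operator is given by the absolutely convergent integral
    (∀ u : 𝓢(Modulation.Eucl d, ℂ),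
      (∀ x, Integrable (fun y => u y / ((‖x - y‖ ^ γ : ℝ) : ℂ))) ∧
      ∃ hu : toTemperedDistributionCLM (Modulation.Eucl d) ℂ volume u ∈
          (Modulation.fracIntOp d γ).domain,
        ∀ φ : 𝓢(Modulation.Eucl d, ℂ),
          Integrable (fun x => φ x * Modulation.fracInt γ u x) ∧
          Modulation.fracIntOp d γ ⟨_, hu⟩ φ = ∫ x, φ x * Modulation.fracInt γ u x) ∧
    -- the operator is defined on the whole modulation space and bounded
    ∃ C : ℝ≥0, ∀ f ∈ Modulation.modSpace g (ENNReal.ofReal p₁) q s,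
      ∃ hf : f ∈ (Modulation.fracIntOp d γ).domain,
        Modulation.fracIntOp d γ ⟨f, hf⟩ ∈ Modulation.modSpace g (ENNReal.ofReal p₂) q s ∧
        Modulation.modNorm g (ENNReal.ofReal p₂) q s (Modulation.fracIntOp d γ ⟨f, hf⟩) ≤
          C * Modulation.modNorm g (ENNReal.ofReal p₁) q s f := by
  have hd : (0 : ℝ) < d := hγ₀.trans hγd
  have hp₂ : 0 < p₂ := zero_lt_one.trans (hp₁.trans hp₁₂)
  refine ⟨fun u => ⟨Modulation.integrable_schwartz_div_norm_rpow hγ₀ hγd u, ?_⟩, ?_⟩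
  · obtain ⟨h, hh, hint⟩ := Modulation.exists_isFracInt_schwartz hγ₀ hγd u
    obtain ⟨hu, rfl⟩ := Modulation.mem_domain_fracIntOp_of_isFracInt hh
    exact ⟨hu, hint⟩
  · obtain ⟨C, hC⟩ := Modulation.exists_modNorm_le_of_isFracInt hγ₀ hγd hp₁ hp₁₂ hp
    refine ⟨C, fun f hf => ?_⟩
    -- the Hölder tail of the kernel decays with exponent `d / p₂`
    have hpa : d * (1 - 1 / p₁) - γ = -(d / p₂) := by
      have e : d * (γ / d) = γ := mul_div_cancel₀ γ hd.ne'
      rw [div_eq_mul_one_div (d : ℝ) p₂, ← hp]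
      linear_combination e
    obtain ⟨h, hh⟩ := Modulation.exists_isFracInt_of_mem_modSpace hγ₀ hγd hp₁
      (div_pos hd hp₂) hpa hq hs hg hf
    obtain ⟨hf', rfl⟩ := Modulation.mem_domain_fracIntOp_of_isFracInt hh
    have hle := hC g q s _ _ hh
    exact ⟨hf', hle.trans_lt (ENNReal.mul_lt_top ENNReal.coe_lt_top hf), hle⟩
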